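/- **Setting.** Let $\mathcal X\subset\mathbb R^d$ be non-empty and compact, let $k:\mathcal X\times\mathcal X\to\mathbb R$ be a continuous positive semidefinite kernel with $k(x,x)\le 1$ for all $x$, and let $\mathcal H$ be its reproducing kernel Hilbert space. Fix $\lambda>0$, $R\ge 0$, $\delta\in(0,1)$ and integers $1\le w\le T$. Let $f_1,\dots,f_T\in\mathcal H$ be fixed functions with $\|f_t\|_{\mathcal H}\le B$ for all $t$ and $\sum_{t=1}^{T-1}\|f_{t+1}-f_t\|_{\mathcal H}\le P_T$. In round $t$ the learner queries a (random) point $x_t\in\mathcal X$ and observes $y_t=f_t(x_t)+\eta_t$, where for all $s\in\mathbb R$ $$\mathbb E\big[e^{s\eta_t}\mid\mathcal F_{t-1}\big]\le e^{s^2R^2/2},\qquad \mathcal F_{t-1}=\sigma(x_1,y_1,\dots,x_{t-1},y_{t-1},x_t).$$ The maximum information gain is $\gamma_n=\max_{A\in\mathcal X^n}\tfrac12\ln\det(I_n+\lambda^{-1}K_A)$, where $K_A=[k(a_i,a_j)]_{i,j\le n}$ for $A=(a_1,\dots,a_n)$ (repeated points are allowed). **SW-GP-UCB with window size $w$.** For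 each $t$ let $\mu_{t-1}$ and $\sigma_{t-1}$ be the Gaussian process posterior mean and standard deviation computed from the samples $s=1\vee(t-w),\dots,t-1$ only: $$\mu_{t-1}(x)=\kappa(x)^\top(K+\lambda I)^{-1}Y,\qquad \sigma_{t-1}^2(x)=k(x,x)-\kappa(x)^\top(K+\lambda I)^{-1}\kappa(x),$$ where $K=[k(x_s,x_{s'})]_{s,s'}$, $\kappa(x)=[k(x_s,x)]_s$ and $Y=[y_s]_s$. The first query $x_1$ is arbitrary (the algorithm starts from $\mu_0=\sigma_0=0$), and for $t\ge 2$ $$x_t\in\operatorname*{arg\,max}_{x\in\mathcal X}\ \mu_{t-1}(x)+\beta_t\,\sigma_{t-1}(x),\qquad \beta_t=B+\frac{R}{\sqrt\lambda}\sqrt{2\gamma_{t\wedge w}+2\ln(T/\delta)},$$ with arbitrary tie-breaking. **Theorem.** There is a constant $C>0$ depending only on $\lambda$ such that in every such setting, with probability at least $1-\delta$, the dynamic regret $\mathcal R(T)=\sum_{t=1}^T\big(\max_{x\in\mathcal X}f_t(x)-f_t(x_t)\big)$ satisfies $$\mathcal R(T)\le C\left(\sqrt{\gamma_w}\,w^{3/2}P_T+\beta_T(\delta)\,T\sqrt{\frac{\gamma_w}{w}}\right),\qquad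 \beta_T(\delta)=B+\frac{R}{\sqrt\lambda}\sqrt{2\gamma_w+2\ln(T/\delta)}.$$ -/

import Mathlib

open MeasureTheory Matrix

noncomputable section

namespace SWGPUCB

section GaussianProcess

variable {X : Type*} {ι : Type*}

/-- The kernel matrix `[k (p i) (p j)]` of a family of points `p`. -/
def kernelMatrix (k : X → X → ℝ) (p : ι → X) : Matrix ι ι ℝ :=
  Matrix.of fun i j => k (p i) (p j)

/-- The vector `[k (p i) x]` of kernel values between the points `p` and `x`. -/
def kvec (k : X → X → ℝ) (p : ι → X) (x : X) : ι → ℝ :=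
  fun i => k (p i) x

/-- The posterior mean `k(x)ᵀ (K + lam I)⁻¹ Y` given the observations `(p i, y i)`. -/
def postMean [Fintype ι] [DecidableEq ι] (k : X → X → ℝ) (lam : ℝ)
    (p : ι → X) (y : ι → ℝ) (x : X) : ℝ :=
  kvec k p x ⬝ᵥ ((kernelMatrix k p + lam • (1 : Matrix ι ι ℝ))⁻¹ *ᵥ y)

/-- The posterior covariance `k(x, x') - k(x)ᵀ (K + lam I)⁻¹ k(x')`. -/
def postCov [Fintype ι] [DecidableEq ι] (k : X → X → ℝ) (lam : ℝ)
    (p : ι → X) (x x' : X) : ℝ :=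
  k x x' - kvec k p x ⬝ᵥ ((kernelMatrix k p + lam • (1 : Matrix ι ι ℝ))⁻¹ *ᵥ kvec k p x')

/-- The posterior standard deviation. -/
def postStd [Fintype ι] [DecidableEq ι] (k : X → X → ℝ) (lam : ℝ)
    (p : ι → X) (x : X) : ℝ :=
  Real.sqrt (postCov k lam p x x)

/-- The maximum information gain `γ_n`: the maximum over all `n`-tuples `A` of points (repetitions
are allowed, as they are for query points) of `(1/2) ln |I + lam⁻¹ K_A|`. -/
def maxInfoGain (k : X → X → ℝ) (lam : ℝ) (n : ℕ) : ℝ :=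
  ⨆ A : Fin n → X, (1 / 2 : ℝ) * Real.log ((1 : Matrix (Fin n) (Fin n) ℝ) + lam⁻¹ • kernelMatrix k A).det

/-- The confidence width `B + (R / √lam) √(2 γ_n + 2 ln (T / δ))`. -/
def confWidth (k : X → X → ℝ) (lam B R δ : ℝ) (T n : ℕ) : ℝ :=
  B + 1 / Real.sqrt lam * R *
    Real.sqrt (2 * maxInfoGain k lam n + 2 * Real.log ((T : ℝ) / δ))

/-- The rounds whose samples are used to choose the query point of round `t`: the most recent `w`
rounds `max 1 (t - w), …, t - 1`. -/
def window (w t : ℕ) : Finset ℕ :=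
  Finset.Ico (max 1 (t - w)) t

/-- The sliding-window posterior mean `μ_{t-1}(z)`, from queries `x` and rewards `y`. -/
def swMean (k : X → X → ℝ) (lam : ℝ) (w : ℕ) (x : ℕ → X) (y : ℕ → ℝ) (t : ℕ) (z : X) : ℝ :=
  postMean k lam (fun s : window w t => x s) (fun s : window w t => y s) z

/-- The sliding-window posterior standard deviation `σ_{t-1}(z)`. -/
def swStd (k : X → X → ℝ) (lam : ℝ) (w : ℕ) (x : ℕ → X) (t : ℕ) (z : X) : ℝ :=
  postStd k lam (fun s : window w t => x s) z

/-- The acquisition function `μ_{t-1}(z) + β_t σ_{t-1}(z)` of SW-GP-UCB with horizon `T`, where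
`β_t` is the confidence width with information gain `γ_{min t w}`. -/
def ucb (k : X → X → ℝ) (lam B R δ : ℝ) (T w : ℕ) (x : ℕ → X) (y : ℕ → ℝ) (t : ℕ) (z : X) : ℝ :=
  swMean k lam w x y t z + confWidth k lam B R δ T (min t w) * swStd k lam w x t z

/-- The queries `x 1, …, x T` are those of a run of SW-GP-UCB with observed rewards `y`: each query
maximizes the acquisition function, with any tie-breaking. Before the first observation the
algorithm is initialized with `μ = σ = 0`, so every point is a maximizer at round `1`, which
therefore is unconstrained. -/
def IsRun (k : X → X → ℝ) (lam B R δ : ℝ) (T w : ℕ) (x : ℕ → X) (y : ℕ → ℝ) : Prop :=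
  ∀ t ∈ Finset.Icc 2 T, ∀ z : X,
    ucb k lam B R δ T w x y t z ≤ ucb k lam B R δ T w x y t (x t)

/-- The dynamic regret `∑_{t=1}^T (max_z f_t(z) - f_t(x_t))`. -/
def dynamicRegret (f : ℕ → X → ℝ) (x : ℕ → X) (T : ℕ) : ℝ :=
  ∑ t ∈ Finset.Icc 1 T, ((⨆ z : X, f t z) - f t (x t))

end GaussianProcess

section Noise

variable {Ω X : Type*}

/-- The noisy evaluation `y_t = f_t(x_t) + η_t`. -/
def reward (f : ℕ → X → ℝ) (x : ℕ → Ω → X) (η : ℕ → Ω → ℝ) (t : ℕ) (ω : Ω) : ℝ :=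
  f t (x t ω) + η t ω

/-- The σ-algebra `ℱ_{t-1}` generated by `x_1, y_1, …, x_{t-1}, y_{t-1}` and `x_t`. -/
@[reducible] def history [MeasurableSpace X] (x : ℕ → Ω → X) (y : ℕ → Ω → ℝ) (t : ℕ) : MeasurableSpace Ω :=
  (⨆ s ∈ Finset.Icc 1 t, MeasurableSpace.comap (x s) inferInstance) ⊔
    (⨆ s ∈ Finset.Ico 1 t, MeasurableSpace.comap (y s) inferInstance)

/-- `ξ` is conditionally `R`-sub-Gaussian given the σ-algebra `m`:
`E[exp(s ξ) | m] ≤ exp(s² R² / 2)` for all real `s`. -/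
def CondSubGaussian {mΩ : MeasurableSpace Ω} (μ : Measure Ω) (m : MeasurableSpace Ω) (R : ℝ)
    (ξ : Ω → ℝ) : Prop :=
  ∀ s : ℝ, Integrable (fun ω => Real.exp (s * ξ ω)) μ ∧
    μ[fun ω => Real.exp (s * ξ ω) | m] ≤ᵐ[μ] fun _ => Real.exp (s ^ 2 * R ^ 2 / 2)

end Noise

end SWGPUCB

end

/-!
The proof follows the optimism principle, with all constants explicit. Write `φ x` for the kernel
function at `x` in the Hilbert space `H`, so that `k x y = ⟪φ x, φ y⟫` and `f x = ⟪φ x, f⟫`.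

*Confidence band.* The posterior mean is linear in the observations, with the ridge regression
weights `a = (K + lam I)⁻¹ k(x)`, and the posterior variance is the optimal value
`‖φ x - ∑ aᵢ φ(pᵢ)‖² + lam |a|²` of that regression (`postCov_self_eq`, `postCov_self_le`). Hence
the bias for the current function is at most `B σ(x)`, the noise contributes at most
`σ(x) (ηᵀ K (K + lam I)⁻¹ η / lam)^(1/2)` (`weights_dotProduct_sq_le`), and the functions of earlier
rounds of the window, which differ from the current one by at most the variation inside the window,
contribute at most `|a| √w` times that variation, where `|a|² ≤ k(x, x) / lam`
(`abs_swMean_sub_le`).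

*Noise.* For each round the window is fixed, so a self-normalized bound at a fixed time suffices,
and a union bound over the rounds costs the factor `T / δ`. The bound (`measure_noiseForm_gt_le`) is
Markov's inequality for `exp (ηᵀ K (K + lam I)⁻¹ η / (2 R²)) / |I + K / lam|^(1/2)`, the average
over a Gaussian process `g` with covariance `k / lam` of the likelihood ratios
`exp (∑ (g(xᵢ) ηᵢ / R - g(xᵢ)² / 2))`. By block elimination (`infoDet_option`, `noiseForm_option`),
one more observation multiplies it by the average of a one-dimensional likelihood ratio over a
predictable normal law, the posterior law of the value of `g` at the new point; so only
one-dimensional Gaussian integrals occur and the mixture is a supermartingale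
(`lintegral_mixture_le_one`).

*Variances.* Cut the horizon into blocks of `w` rounds. Inside a block, every window contains the
earlier rounds of the block, and discarding data does not decrease the posterior variance
(`postCov_self_anti`); so the squared widths of a block add up to a multiple of `γ_w` by the chain
rule for the log-determinant (`sum_block_swStd_sq_le`). Cauchy–Schwarz over the at most `2 T / w`
blocks gives the term `T (γ_w / w)^(1/2)` (`sum_swStd_le`).

*Small kernels.* The drift and the first round are only bounded in terms of `k(x, x)`; the factor
`√γ_w` appears because `k(x, x)` is at most a multiple of `γ_1 ≤ γ_w`
(`kernel_self_le_maxInfoGain`).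
-/

namespace SWGPUCB

/-! ### The posterior in feature space -/

section Posterior

variable {X H ι : Type*} [Fintype ι]
  [NormedAddCommGroup H] [InnerProductSpace ℝ H] {k : X → X → ℝ} {lam : ℝ} {φ : X → H}

theorem kernelMatrix_posSemidef (hk : ∀ x y, k x y = inner ℝ (φ x) (φ y)) (p : ι → X) :
    (kernelMatrix k p).PosSemidef := by
  have : kernelMatrix k p = gram ℝ (fun i => φ (p i)) := by
    ext i j; simp [kernelMatrix, gram, hk]
  rw [this]; exact posSemidef_gram ℝ _

theorem kernelMatrix_mulVec (hk : ∀ x y, k x y = inner ℝ (φ x) (φ y)) (p : ι → X) (c : ι → ℝ)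
    (i : ι) : (kernelMatrix k p *ᵥ c) i = inner ℝ (∑ j, c j • φ (p j)) (φ (p i)) := by
  simp only [mulVec, dotProduct, kernelMatrix, of_apply, hk, sum_inner, inner_smul_left]
  refine Finset.sum_congr rfl fun j _ => ?_
  simp [mul_comm, real_inner_comm]

variable [DecidableEq ι]

theorem ridge_posDef (hk : ∀ x y, k x y = inner ℝ (φ x) (φ y)) (hlam : 0 < lam) (p : ι → X) :
    (kernelMatrix k p + lam • (1 : Matrix ι ι ℝ)).PosDef :=
  (PosDef.one.smul hlam).posSemidef_add (kernelMatrix_posSemidef hk p)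

theorem ridge_isUnit_det (hk : ∀ x y, k x y = inner ℝ (φ x) (φ y)) (hlam : 0 < lam) (p : ι → X) :
    IsUnit (kernelMatrix k p + lam • (1 : Matrix ι ι ℝ)).det :=
  (isUnit_iff_isUnit_det _).1 (ridge_posDef hk hlam p).isUnit

/-- The weights `(K + lam I)⁻¹ k(x)` with which the posterior mean at `x` averages the
observations. -/
noncomputable def weights (k : X → X → ℝ) (lam : ℝ) (p : ι → X) (x : X) : ι → ℝ :=
  (kernelMatrix k p + lam • (1 : Matrix ι ι ℝ))⁻¹ *ᵥ kvec k p x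

theorem ridge_inv_symm (hk : ∀ x y, k x y = inner ℝ (φ x) (φ y)) (p : ι → X) (u v : ι → ℝ) :
    u ⬝ᵥ ((kernelMatrix k p + lam • (1 : Matrix ι ι ℝ))⁻¹ *ᵥ v) =
      ((kernelMatrix k p + lam • (1 : Matrix ι ι ℝ))⁻¹ *ᵥ u) ⬝ᵥ v := by
  have hs : (kernelMatrix k p + lam • (1 : Matrix ι ι ℝ))ᵀ =
      kernelMatrix k p + lam • (1 : Matrix ι ι ℝ) := by
    ext i j
    simp [kernelMatrix, hk, real_inner_comm, Matrix.one_apply, eq_comm]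
  rw [dotProduct_mulVec, ← mulVec_transpose, transpose_nonsing_inv, hs]

theorem postMean_eq (hk : ∀ x y, k x y = inner ℝ (φ x) (φ y)) (p : ι → X) (y : ι → ℝ) (x : X) :
    postMean k lam p y x = weights k lam p x ⬝ᵥ y :=
  ridge_inv_symm hk p _ _

theorem ridge_mulVec_inv (hk : ∀ x y, k x y = inner ℝ (φ x) (φ y)) (hlam : 0 < lam) (p : ι → X)
    (u : ι → ℝ) :
    kernelMatrix k p *ᵥ ((kernelMatrix k p + lam • (1 : Matrix ι ι ℝ))⁻¹ *ᵥ u) +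
      lam • ((kernelMatrix k p + lam • (1 : Matrix ι ι ℝ))⁻¹ *ᵥ u) = u := by
  have h := mul_nonsing_inv _ (ridge_isUnit_det hk hlam p)
  have : (kernelMatrix k p + lam • (1 : Matrix ι ι ℝ)) *ᵥ
      ((kernelMatrix k p + lam • (1 : Matrix ι ι ℝ))⁻¹ *ᵥ u) = u := by
    rw [mulVec_mulVec, h, one_mulVec]
  rwa [add_mulVec, smul_mulVec, one_mulVec] at this

/-- The residual `φ(x) - ∑ i, aᵢ φ(pᵢ)` of the ridge regression of `φ(x)` on the features of the
data points. -/
noncomputable def residual (k : X → X → ℝ) (lam : ℝ) (φ : X → H) (p : ι → X) (x : X) : H :=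
  φ x - ∑ i, weights k lam p x i • φ (p i)

theorem inner_residual (hk : ∀ x y, k x y = inner ℝ (φ x) (φ y)) (hlam : 0 < lam) (p : ι → X)
    (x : X) (i : ι) :
    inner ℝ (residual k lam φ p x) (φ (p i)) = lam * weights k lam p x i := by
  have h := congrFun (ridge_mulVec_inv hk hlam p (kvec k p x)) i
  rw [Pi.add_apply, kernelMatrix_mulVec hk] at h
  rw [residual, inner_sub_left]
  have h2 : kvec k p x i = inner ℝ (φ x) (φ (p i)) := by simp [kvec, hk, real_inner_comm]
  rw [h2] at h
  simp only [Pi.smul_apply, smul_eq_mul] at h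
  unfold weights
  linarith

theorem inner_residual_sum (hk : ∀ x y, k x y = inner ℝ (φ x) (φ y)) (hlam : 0 < lam)
    (p : ι → X) (x : X) (c : ι → ℝ) :
    inner ℝ (residual k lam φ p x) (∑ i, c i • φ (p i)) = lam * (weights k lam p x ⬝ᵥ c) := by
  simp only [inner_sum, inner_smul_right, inner_residual hk hlam, dotProduct, Finset.mul_sum]
  exact Finset.sum_congr rfl fun _ _ => by ring

/-- The posterior variance is the optimal value of a ridge regression: it is the sum of the squared
norm of the residual and of `lam` times that of the weights. -/
theorem postCov_self_eq (hk : ∀ x y, k x y = inner ℝ (φ x) (φ y)) (hlam : 0 < lam) (p : ι → X)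
    (x : X) :
    postCov k lam p x x =
      ‖residual k lam φ p x‖ ^ 2 + lam * (weights k lam p x ⬝ᵥ weights k lam p x) := by
  have h : ‖residual k lam φ p x‖ ^ 2 =
      inner ℝ (residual k lam φ p x) (φ x) - inner ℝ (residual k lam φ p x)
        (∑ i, weights k lam p x i • φ (p i)) := by
    rw [← real_inner_self_eq_norm_sq, ← inner_sub_right]; rfl
  rw [h, inner_residual_sum hk hlam]
  have h2 : inner ℝ (residual k lam φ p x) (φ x) = postCov k lam p x x := by
    rw [residual, inner_sub_left, sum_inner, postCov, hk]
    congr 1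
    simp only [dotProduct, inner_smul_left, weights, kvec, hk]
    exact Finset.sum_congr rfl fun i _ => by simp [mul_comm]
  rw [h2]; ring

/-- The ridge weights minimize the penalized distance from `φ(x)` to the span of the data. -/
theorem postCov_self_le (hk : ∀ x y, k x y = inner ℝ (φ x) (φ y)) (hlam : 0 < lam) (p : ι → X)
    (x : X) (c : ι → ℝ) :
    postCov k lam p x x ≤ ‖φ x - ∑ i, c i • φ (p i)‖ ^ 2 + lam * (c ⬝ᵥ c) := by
  set a := weights k lam p x with ha
  have h1 : φ x - ∑ i, c i • φ (p i) =
      residual k lam φ p x + ∑ i, (a - c) i • φ (p i) := by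
    simp only [residual, Pi.sub_apply, sub_smul, Finset.sum_sub_distrib]; abel
  have h2 : c ⬝ᵥ c = a ⬝ᵥ a - 2 * (a ⬝ᵥ (a - c)) + (a - c) ⬝ᵥ (a - c) := by
    simp only [sub_dotProduct, dotProduct_sub, dotProduct_comm c a]; ring
  have h3 : 0 ≤ (a - c) ⬝ᵥ (a - c) := by simpa using dotProduct_star_self_nonneg (a - c)
  rw [h1, norm_add_sq_real, inner_residual_sum hk hlam, h2, postCov_self_eq hk hlam, ← ha]
  have := sq_nonneg ‖∑ i, (a - c) i • φ (p i)‖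
  have := mul_nonneg hlam.le h3
  linarith

theorem postCov_self_nonneg (hk : ∀ x y, k x y = inner ℝ (φ x) (φ y)) (hlam : 0 < lam)
    (p : ι → X) (x : X) : 0 ≤ postCov k lam p x x := by
  rw [postCov_self_eq hk hlam]
  have : 0 ≤ weights k lam p x ⬝ᵥ weights k lam p x := by
    simpa using dotProduct_star_self_nonneg (weights k lam p x)
  positivity

theorem postCov_self_le_kernel (hk : ∀ x y, k x y = inner ℝ (φ x) (φ y)) (hlam : 0 < lam)
    (p : ι → X) (x : X) : postCov k lam p x x ≤ k x x := by
  have := postCov_self_le hk hlam p x 0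
  simpa [hk] using this

theorem sum_extend_zero {κ ι M : Type*} [Fintype κ] [Fintype ι] [AddCommMonoid M]
    (e : κ ↪ ι) (c : κ → ℝ) (F : ℝ → ι → M) (hF : ∀ i, F 0 i = 0) :
    ∑ i, F (Function.extend e c 0 i) i = ∑ j, F (c j) (e j) := by
  rw [← Finset.sum_subset (Finset.subset_univ (Finset.univ.map e)), Finset.sum_map]
  · exact Finset.sum_congr rfl fun j _ => by rw [e.injective.extend_apply]
  · intro i _ hi
    rw [Function.extend_apply' _ _ _ (by simpa using hi)]
    exact hF i

/-- Discarding data does not decrease the posterior variance. -/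
theorem postCov_self_anti {κ : Type*} [Fintype κ] [DecidableEq κ]
    (hk : ∀ x y, k x y = inner ℝ (φ x) (φ y)) (hlam : 0 < lam)
    (p : ι → X) (e : κ ↪ ι) (x : X) :
    postCov k lam p x x ≤ postCov k lam (fun i => p (e i)) x x := by
  set c := weights k lam (fun i => p (e i)) x with hc
  have h := postCov_self_le hk hlam p x (Function.extend e c 0)
  refine h.trans_eq ?_
  rw [postCov_self_eq hk hlam, residual, ← hc]
  congr 1
  · rw [sum_extend_zero e c (fun r i => r • φ (p i)) (by simp)]
  · congr 1
    exact sum_extend_zero e c (fun r _ => r * r) (by simp)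

theorem weights_sq_le (hk : ∀ x y, k x y = inner ℝ (φ x) (φ y)) (hlam : 0 < lam)
    (p : ι → X) (x : X) : weights k lam p x ⬝ᵥ weights k lam p x ≤ k x x / lam := by
  rw [le_div_iff₀ hlam]
  have h1 := postCov_self_le_kernel hk hlam p x
  rw [postCov_self_eq hk hlam] at h1
  have := sq_nonneg ‖residual k lam φ p x‖
  linarith

/-- The error of the posterior mean computed from the exact values of `⟪f, φ ·⟫`. -/
theorem abs_bias_le (hk : ∀ x y, k x y = inner ℝ (φ x) (φ y)) (hlam : 0 < lam)
    (p : ι → X) (x : X) (f : H) :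
    |weights k lam p x ⬝ᵥ (fun i => inner ℝ (φ (p i)) f) - inner ℝ (φ x) f| ≤
      ‖f‖ * postStd k lam p x := by
  have h : inner ℝ (residual k lam φ p x) f =
      inner ℝ (φ x) f - weights k lam p x ⬝ᵥ (fun i => inner ℝ (φ (p i)) f) := by
    simp [residual, inner_sub_left, sum_inner, inner_smul_left, dotProduct]
  rw [abs_sub_comm, ← h]
  refine (abs_real_inner_le_norm _ _).trans ?_
  rw [mul_comm]
  refine mul_le_mul_of_nonneg_left ?_ (norm_nonneg _)
  refine Real.le_sqrt_of_sq_le ?_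
  rw [postCov_self_eq hk hlam]
  have : 0 ≤ weights k lam p x ⬝ᵥ weights k lam p x := by
    simpa using dotProduct_star_self_nonneg (weights k lam p x)
  have := mul_nonneg hlam.le this
  linarith

/-- The quadratic form `uᵀ K (K + lam I)⁻¹ u` that governs the deviations of the posterior mean,
written as `|u|² - lam uᵀ (K + lam I)⁻¹ u`. -/
noncomputable def noiseForm (k : X → X → ℝ) (lam : ℝ) (p : ι → X) (u : ι → ℝ) : ℝ :=
  u ⬝ᵥ u - lam * (u ⬝ᵥ ((kernelMatrix k p + lam • (1 : Matrix ι ι ℝ))⁻¹ *ᵥ u))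

/-- Cauchy–Schwarz for the noise part of the posterior mean, in the space `H × ℝ^ι` weighted by
`lam` in the second factor. -/
theorem weights_dotProduct_sq_le (hk : ∀ x y, k x y = inner ℝ (φ x) (φ y)) (hlam : 0 < lam)
    (p : ι → X) (x : X) (u : ι → ℝ) :
    (weights k lam p x ⬝ᵥ u) ^ 2 ≤ postCov k lam p x x * (noiseForm k lam p u / lam) := by
  set a := weights k lam p x with ha
  set b := (kernelMatrix k p + lam • (1 : Matrix ι ι ℝ))⁻¹ *ᵥ u with hb
  set h := ∑ i, b i • φ (p i) with hh
  set c := kernelMatrix k p *ᵥ b with hc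
  have hu : c + lam • b = u := ridge_mulVec_inv hk hlam p u
  -- `a ⬝ u = ⟪v, h⟫ + a ⬝ K b`
  have e1 : a ⬝ᵥ u = inner ℝ (residual k lam φ p x) h + a ⬝ᵥ c := by
    rw [hh, inner_residual_sum hk hlam, ← hu, dotProduct_add, dotProduct_smul, smul_eq_mul, ← ha]
    ring
  have e2 : ‖h‖ ^ 2 = b ⬝ᵥ c := by
    rw [← real_inner_self_eq_norm_sq]
    nth_rewrite 2 [hh]
    simp only [inner_sum, inner_smul_right, dotProduct, hc, kernelMatrix_mulVec hk, hh]
  have e3 : noiseForm k lam p u / lam = ‖h‖ ^ 2 + c ⬝ᵥ c / lam := by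
    rw [noiseForm, ← hb, e2, ← hu]
    simp only [add_dotProduct, dotProduct_add, smul_dotProduct, dotProduct_smul, smul_eq_mul,
      dotProduct_comm c b]
    field_simp
    ring
  have cs : (a ⬝ᵥ c) ^ 2 ≤ (a ⬝ᵥ a) * (c ⬝ᵥ c) := by
    have := Finset.sum_mul_sq_le_sq_mul_sq Finset.univ a c
    simpa [dotProduct, pow_two] using this
  have cs2 := real_inner_mul_inner_self_le (residual k lam φ p x) h
  rw [real_inner_self_eq_norm_sq, real_inner_self_eq_norm_sq] at cs2
  have ha0 : 0 ≤ a ⬝ᵥ a := by simpa using dotProduct_star_self_nonneg a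
  have hc0 : 0 ≤ c ⬝ᵥ c := by simpa using dotProduct_star_self_nonneg c
  rw [e1, e3, postCov_self_eq hk hlam, ← ha]
  generalize inner ℝ (residual k lam φ p x) h = r at *
  generalize ‖residual k lam φ p x‖ = n1 at *
  generalize ‖h‖ = n2 at *
  generalize a ⬝ᵥ c = q at *
  generalize a ⬝ᵥ a = A at *
  generalize c ⬝ᵥ c = D at *
  have f1 : |r| ≤ |n1| * |n2| := by
    rw [← abs_mul]; apply sq_le_sq.mp; nlinarith
  have f2 : |q| ≤ √(lam * A) * √(D / lam) := by
    rw [← Real.sqrt_mul (by positivity)]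
    apply Real.abs_le_sqrt
    calc q ^ 2 ≤ A * D := cs
      _ = lam * A * (D / lam) := by field_simp
  have g1 := Real.sq_sqrt (show 0 ≤ lam * A by positivity)
  have g2 := Real.sq_sqrt (show 0 ≤ D / lam by positivity)
  generalize √(lam * A) = s1 at *
  generalize √(D / lam) = s2 at *
  rw [← g1, ← g2, ← sq_abs n1, ← sq_abs n2]
  have : |r + q| ≤ |n1| * |n2| + s1 * s2 := (abs_add_le _ _).trans (add_le_add f1 f2)
  calc (r + q) ^ 2 = |r + q| ^ 2 := (sq_abs _).symm
    _ ≤ (|n1| * |n2| + s1 * s2) ^ 2 := by gcongr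
    _ ≤ _ := by nlinarith [sq_nonneg (|n1| * s2 - s1 * |n2|)]

theorem abs_weights_dotProduct_le (hk : ∀ x y, k x y = inner ℝ (φ x) (φ y)) (hlam : 0 < lam)
    (p : ι → X) (x : X) (u : ι → ℝ) {c : ℝ} (hu : noiseForm k lam p u ≤ c) :
    |weights k lam p x ⬝ᵥ u| ≤ postStd k lam p x * √(c / lam) := by
  rw [postStd, ← Real.sqrt_mul (postCov_self_nonneg hk hlam p x)]
  refine Real.abs_le_sqrt ((weights_dotProduct_sq_le hk hlam p x u).trans ?_)
  have := postCov_self_nonneg hk hlam p x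
  gcongr

end Posterior

/-! ### Adding one observation, and the information gain -/

section InfoGain

variable {X H ι κ : Type*} [Fintype ι] [DecidableEq ι] [Fintype κ] [DecidableEq κ]
  [NormedAddCommGroup H] [InnerProductSpace ℝ H] {k : X → X → ℝ} {lam : ℝ} {φ : X → H}

/-- The determinant `|I + lam⁻¹ K|`, whose logarithm is twice the information gain of the
points `p`. -/
noncomputable def infoDet (k : X → X → ℝ) (lam : ℝ) (p : ι → X) : ℝ :=
  ((1 : Matrix ι ι ℝ) + lam⁻¹ • kernelMatrix k p).det

theorem infoDet_eq (hlam : 0 < lam) (p : ι → X) :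
    infoDet k lam p =
      lam⁻¹ ^ Fintype.card ι * (kernelMatrix k p + lam • (1 : Matrix ι ι ℝ)).det := by
  rw [infoDet, ← det_smul, smul_add, smul_smul, inv_mul_cancel₀ hlam.ne', one_smul, add_comm]

/-- The Schur complement of the old data in the kernel matrix is the posterior variance of the new
point. -/
theorem infoDet_option (hk : ∀ x y, k x y = inner ℝ (φ x) (φ y)) (hlam : 0 < lam)
    (p : Option ι → X) :
    infoDet k lam p = infoDet k lam (fun i => p (some i)) *
      (1 + postCov k lam (fun i => p (some i)) (p none) (p none) / lam) := by
  rw [infoDet_eq hlam, infoDet_eq hlam]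
  set q : ι → X := fun i => p (some i) with hq
  set N := kernelMatrix k q + lam • (1 : Matrix ι ι ℝ) with hN
  have hdet := ridge_isUnit_det hk hlam q
  have : Invertible N := invertibleOfIsUnitDet _ hdet
  have hb : (kernelMatrix k p + lam • (1 : Matrix (Option ι) (Option ι) ℝ)).submatrix
      (Equiv.optionEquivSumPUnit.{0} ι).symm (Equiv.optionEquivSumPUnit.{0} ι).symm =
      fromBlocks N (of fun i (_ : Unit) => kvec k q (p none) i)
        (of fun (_ : Unit) i => kvec k q (p none) i)
        (of fun (_ _ : Unit) => k (p none) (p none) + lam) := by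
    ext (i | i) (j | j)
    · simp [hN, hq, kernelMatrix, Matrix.one_apply]
    · simp [kvec, hq, kernelMatrix]
    · simp [kvec, hq, kernelMatrix, hk, real_inner_comm]
    · simp [kernelMatrix]
  rw [← det_submatrix_equiv_self (Equiv.optionEquivSumPUnit.{0} ι).symm, hb, det_fromBlocks₁₁]
  have h1 : det ((of fun (_ _ : Unit) => k (p none) (p none) + lam) -
      (of fun (_ : Unit) i => kvec k q (p none) i) * ⅟N *
        (of fun i (_ : Unit) => kvec k q (p none) i)) =
      postCov k lam q (p none) (p none) + lam := by
    rw [det_unique, invOf_eq_nonsing_inv, Matrix.mul_assoc, Matrix.sub_apply]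
    have : ((of fun (_ : Unit) i => kvec k q (p none) i) * (N⁻¹ *
        (of fun i (_ : Unit) => kvec k q (p none) i))) default default =
        kvec k q (p none) ⬝ᵥ (N⁻¹ *ᵥ kvec k q (p none)) := by
      simp [Matrix.mul_apply, dotProduct, mulVec]
    rw [this, postCov, ← hN]; simp; ring
  rw [h1, Fintype.card_option, pow_succ]
  field_simp
  ring

theorem noiseForm_option (hk : ∀ x y, k x y = inner ℝ (φ x) (φ y)) (hlam : 0 < lam)
    (p : Option ι → X) (u : Option ι → ℝ) :
    noiseForm k lam p u = noiseForm k lam (fun i => p (some i)) (fun i => u (some i)) +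
      (u none ^ 2 - lam *
        (u none - postMean k lam (fun i => p (some i)) (fun i => u (some i)) (p none)) ^ 2 /
          (lam + postCov k lam (fun i => p (some i)) (p none) (p none))) := by
  set q : ι → X := fun i => p (some i) with hq
  set v : ι → ℝ := fun i => u (some i) with hv
  set N := kernelMatrix k q + lam • (1 : Matrix ι ι ℝ) with hN
  set a := weights k lam q (p none) with ha
  set z := N⁻¹ *ᵥ v with hz
  set m := postMean k lam q v (p none) with hm
  set S := lam + postCov k lam q (p none) (p none) with hS
  have hSpos : 0 < S := add_pos_of_pos_of_nonneg hlam (postCov_self_nonneg hk hlam q _)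
  set r := (u none - m) / S with hr
  -- the solution of the enlarged system by block elimination
  set y : Option ι → ℝ := fun o => o.elim r (fun i => z i - r * a i) with hy
  have hmv : m = a ⬝ᵥ v := postMean_eq hk q v _
  have hsol : (kernelMatrix k p + lam • (1 : Matrix (Option ι) (Option ι) ℝ)) *ᵥ y = u := by
    have e1 : kernelMatrix k q *ᵥ z + lam • z = v := ridge_mulVec_inv hk hlam q v
    have e2 : kernelMatrix k q *ᵥ a + lam • a = kvec k q (p none) := ridge_mulVec_inv hk hlam q _
    ext (_ | i)
    · have h1 : kvec k q (p none) ⬝ᵥ z = m := rfl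
      have h2 : k (p none) (p none) = S - lam + kvec k q (p none) ⬝ᵥ a := by
        simp only [hS, postCov, ha, weights]; ring
      have h3 : r * S = u none - m := div_mul_cancel₀ _ hSpos.ne'
      rw [add_mulVec, smul_mulVec, one_mulVec]
      simp only [Pi.add_apply, Pi.smul_apply, mulVec, dotProduct, Fintype.sum_option,
        kernelMatrix, of_apply, smul_eq_mul, hy, Option.elim]
      have h4 : ∑ i, k (p none) (p (some i)) * (z i - r * a i) =
          kvec k q (p none) ⬝ᵥ z - r * (kvec k q (p none) ⬝ᵥ a) := by
        simp only [dotProduct, Finset.mul_sum, ← Finset.sum_sub_distrib]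
        refine Finset.sum_congr rfl fun i _ => ?_
        simp only [kvec, hq, hk, real_inner_comm]; ring
      rw [h4, h1, h2]
      linear_combination h3
    · have h1 := congrFun e1 i
      have h2 := congrFun e2 i
      rw [add_mulVec, smul_mulVec, one_mulVec]
      simp only [Pi.add_apply, Pi.smul_apply, mulVec, dotProduct, Fintype.sum_option,
        kernelMatrix, of_apply, smul_eq_mul, hy, Option.elim] at h1 h2 ⊢
      have h4 : ∑ j, k (p (some i)) (p (some j)) * (z j - r * a j) =
          ∑ j, k (q i) (q j) * z j - r * ∑ j, k (q i) (q j) * a j := by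
        simp only [Finset.mul_sum, ← Finset.sum_sub_distrib]
        exact Finset.sum_congr rfl fun j _ => by simp only [hq]; ring
      have h5 : k (p (some i)) (p none) = kvec k q (p none) i := rfl
      rw [h4, h5, ← h2]
      have h6 : u (some i) = v i := rfl
      rw [h6, ← h1]; ring
  have hinv : (kernelMatrix k p + lam • (1 : Matrix (Option ι) (Option ι) ℝ))⁻¹ *ᵥ u = y := by
    rw [← hsol, mulVec_mulVec, nonsing_inv_mul _ (ridge_isUnit_det hk hlam p), one_mulVec]
  rw [noiseForm, noiseForm, hinv, ← hN, ← hz]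
  have e1 : u ⬝ᵥ y = u none * r + (v ⬝ᵥ z - r * m) := by
    rw [hmv]
    simp only [dotProduct, Fintype.sum_option, hy, Option.elim, Finset.mul_sum,
      ← Finset.sum_sub_distrib]
    congr 1
    exact Finset.sum_congr rfl fun i _ => by simp only [hv]; ring
  have e2 : u ⬝ᵥ u = u none ^ 2 + v ⬝ᵥ v := by
    simp only [dotProduct, Fintype.sum_option, hv]; ring
  have e3 : lam * (u none - m) ^ 2 / S = lam * (u none - m) * r := by rw [hr]; ring
  rw [e1, e2, e3]; ring

theorem infoDet_comp_equiv (e : κ ≃ ι) (p : ι → X) :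
    infoDet k lam (fun i => p (e i)) = infoDet k lam p := by
  rw [infoDet, infoDet, ← det_submatrix_equiv_self e]
  congr 1
  ext i j
  simp [kernelMatrix, Matrix.one_apply]

theorem noiseForm_comp_equiv (e : κ ≃ ι) (p : ι → X) (u : ι → ℝ) :
    noiseForm k lam (fun i => p (e i)) (fun i => u (e i)) = noiseForm k lam p u := by
  have h : kernelMatrix k (fun i => p (e i)) + lam • (1 : Matrix κ κ ℝ) =
      (kernelMatrix k p + lam • (1 : Matrix ι ι ℝ)).submatrix e e := by
    ext i j
    simp [kernelMatrix, Matrix.one_apply]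
  have h2 : (fun i => u (e i)) = u ∘ e := rfl
  have h3 (v : ι → ℝ) : (u ∘ e) ⬝ᵥ (v ∘ e) = u ⬝ᵥ v := comp_equiv_dotProduct_comp_equiv ..
  rw [noiseForm, noiseForm, h, inv_submatrix_equiv, h2, submatrix_mulVec_equiv, h3]
  congr 3
  rw [Function.comp_assoc]
  simp [h3]

theorem infoDet_insert {J : Type*} [DecidableEq J] (hk : ∀ x y, k x y = inner ℝ (φ x) (φ y))
    (hlam : 0 < lam) (q : J → X) (s : Finset J) {b : J} (hb : b ∉ s) :
    infoDet k lam (fun i : (insert b s : Finset J) => q i) =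
      infoDet k lam (fun i : s => q i) *
        (1 + postCov k lam (fun i : s => q i) (q b) (q b) / lam) := by
  rw [← infoDet_comp_equiv (Finset.subtypeInsertEquivOption hb).symm, infoDet_option hk hlam]
  rfl

theorem noiseForm_insert {J : Type*} [DecidableEq J] (hk : ∀ x y, k x y = inner ℝ (φ x) (φ y))
    (hlam : 0 < lam) (q : J → X) (u : J → ℝ) (s : Finset J) {b : J} (hb : b ∉ s) :
    noiseForm k lam (fun i : (insert b s : Finset J) => q i) (fun i => u i) =
      noiseForm k lam (fun i : s => q i) (fun i => u i) +
      (u b ^ 2 - lam * (u b - postMean k lam (fun i : s => q i) (fun i => u i) (q b)) ^ 2 /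
        (lam + postCov k lam (fun i : s => q i) (q b) (q b))) := by
  rw [← noiseForm_comp_equiv (Finset.subtypeInsertEquivOption hb).symm, noiseForm_option hk hlam]
  rfl

theorem infoDet_mem_Icc_fin (hk : ∀ x y, k x y = inner ℝ (φ x) (φ y)) (hlam : 0 < lam)
    (hk1 : ∀ x, k x x ≤ 1) : ∀ (n : ℕ) (p : Fin n → X),
    infoDet k lam p ∈ Set.Icc 1 ((1 + 1 / lam) ^ n)
  | 0, p => by simp [infoDet]
  | n + 1, p => by
    rw [← infoDet_comp_equiv (finSuccEquiv n).symm, infoDet_option hk hlam]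
    obtain ⟨h1, h2⟩ := infoDet_mem_Icc_fin hk hlam hk1 n
      (fun i => p ((finSuccEquiv n).symm (some i)))
    set q := fun i => p ((finSuccEquiv n).symm (some i))
    set x := p ((finSuccEquiv n).symm none)
    have h3 := div_nonneg (postCov_self_nonneg hk hlam q x) hlam.le
    have h4 : postCov k lam q x x / lam ≤ 1 / lam := by
      gcongr; exact (postCov_self_le_kernel hk hlam q x).trans (hk1 x)
    refine ⟨one_le_mul_of_one_le_of_one_le h1 (by linarith), ?_⟩
    rw [pow_succ]
    gcongr

theorem infoDet_mem_Icc (hk : ∀ x y, k x y = inner ℝ (φ x) (φ y)) (hlam : 0 < lam)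
    (hk1 : ∀ x, k x x ≤ 1) (p : ι → X) :
    infoDet k lam p ∈ Set.Icc 1 ((1 + 1 / lam) ^ Fintype.card ι) := by
  rw [← infoDet_comp_equiv (Fintype.equivFin ι).symm]
  exact infoDet_mem_Icc_fin hk hlam hk1 _ _

/-- The supremum that defines the maximum information gain is that of a bounded set. -/
theorem bddAbove_infoGain (hk : ∀ x y, k x y = inner ℝ (φ x) (φ y)) (hlam : 0 < lam)
    (hk1 : ∀ x, k x x ≤ 1) (n : ℕ) :
    BddAbove (Set.range fun A : Fin n → X => (1 / 2 : ℝ) * Real.log (infoDet k lam A)) := by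
  refine ⟨(1 / 2 : ℝ) * Real.log ((1 + 1 / lam) ^ n), ?_⟩
  rintro _ ⟨A, rfl⟩
  obtain ⟨h1, h2⟩ := infoDet_mem_Icc_fin hk hlam hk1 n A
  have := Real.log_le_log (by linarith) h2
  simp only
  linarith

theorem log_infoDet_le (hk : ∀ x y, k x y = inner ℝ (φ x) (φ y)) (hlam : 0 < lam)
    (hk1 : ∀ x, k x x ≤ 1) (p : ι → X) :
    Real.log (infoDet k lam p) ≤ 2 * maxInfoGain k lam (Fintype.card ι) := by
  rw [← infoDet_comp_equiv (Fintype.equivFin ι).symm]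
  have := le_ciSup (bddAbove_infoGain hk hlam hk1 (Fintype.card ι))
    (fun i => p ((Fintype.equivFin ι).symm i))
  have h2 : (1 / 2 : ℝ) * Real.log (infoDet k lam fun i => p ((Fintype.equivFin ι).symm i)) ≤
    maxInfoGain k lam (Fintype.card ι) := this
  linarith

theorem maxInfoGain_mono [Nonempty X] (hk : ∀ x y, k x y = inner ℝ (φ x) (φ y)) (hlam : 0 < lam)
    (hk1 : ∀ x, k x x ≤ 1) : Monotone (maxInfoGain k lam) := by
  refine monotone_nat_of_le_succ fun n => ciSup_le fun A => ?_
  let x : X := Classical.arbitrary X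
  have h := log_infoDet_le hk hlam hk1 (fun o : Option (Fin n) => o.elim x A)
  rw [infoDet_option hk hlam] at h
  simp only [Option.elim, Fintype.card_option, Fintype.card_fin] at h
  have h0 : 1 ≤ infoDet k lam A := (infoDet_mem_Icc_fin hk hlam hk1 n A).1
  have h1 := div_nonneg (postCov_self_nonneg hk hlam A x) hlam.le
  have h2 : Real.log (infoDet k lam A) ≤
      Real.log (infoDet k lam A * (1 + postCov k lam A x x / lam)) :=
    Real.log_le_log (by linarith) (le_mul_of_one_le_right (by linarith) (by linarith))
  change (1 / 2 : ℝ) * Real.log (infoDet k lam A) ≤ _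
  have h3 : Real.log (infoDet k lam A * (1 + postCov k lam A x x / lam)) ≤
    2 * maxInfoGain k lam (n + 1) := h
  linarith

theorem maxInfoGain_nonneg [Nonempty X] (hk : ∀ x y, k x y = inner ℝ (φ x) (φ y))
    (hlam : 0 < lam) (hk1 : ∀ x, k x x ≤ 1) (n : ℕ) : 0 ≤ maxInfoGain k lam n := by
  have h := log_infoDet_le hk hlam hk1 (fun _ : Fin n => Classical.arbitrary X)
  have h2 := Real.log_nonneg (infoDet_mem_Icc_fin hk hlam hk1 n (fun _ => Classical.arbitrary X)).1
  rw [Fintype.card_fin] at h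
  linarith

/-- Concavity of the logarithm on `[1, 1 + 1 / lam]`. -/
theorem le_log_one_add_div (hlam : 0 < lam) {v : ℝ} (h0 : 0 ≤ v) (h1 : v ≤ 1) :
    v ≤ Real.log (1 + v / lam) / Real.log (1 + 1 / lam) := by
  have hl : 0 < Real.log (1 + 1 / lam) := Real.log_pos (by simpa using hlam)
  rw [le_div_iff₀ hl]
  have hp : (0 : ℝ) < 1 + 1 / lam := by positivity
  have := strictConcaveOn_log_Ioi.concaveOn.2 (Set.mem_Ioi.2 one_pos) (Set.mem_Ioi.2 hp)
    (sub_nonneg.2 h1) h0 (by ring)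
  simp only [smul_eq_mul, Real.log_one, mul_zero, zero_add] at this
  refine this.trans_eq ?_
  congr 1; ring

theorem kernel_self_le_maxInfoGain [Nonempty X] (hk : ∀ x y, k x y = inner ℝ (φ x) (φ y))
    (hlam : 0 < lam) (hk1 : ∀ x, k x x ≤ 1) {w : ℕ} (hw : 1 ≤ w) (x : X) :
    k x x ≤ 2 / Real.log (1 + 1 / lam) * maxInfoGain k lam w := by
  have hl : 0 < Real.log (1 + 1 / lam) := Real.log_pos (by simpa using hlam)
  have h0 : 0 ≤ k x x := by rw [hk]; exact real_inner_self_nonneg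
  refine (le_log_one_add_div hlam h0 (hk1 x)).trans ?_
  rw [div_mul_eq_mul_div]
  gcongr
  have h := log_infoDet_le hk hlam hk1 (fun _ : Fin 1 => x)
  have h2 : infoDet k lam (fun _ : Fin 1 => x) = 1 + k x x / lam := by
    simp [infoDet, kernelMatrix, div_eq_inv_mul]
  rw [h2, Fintype.card_fin] at h
  have := maxInfoGain_mono hk hlam hk1 hw
  linarith

end InfoGain

/-! ### Sub-Gaussian noise with a predictable multiplier -/

section SubGaussian

open scoped ENNReal
open ProbabilityTheory

variable {Ω : Type*} {m mΩ : MeasurableSpace Ω} {μ : Measure Ω} [IsProbabilityMeasure μ]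
  {R : ℝ} {ξ : Ω → ℝ}

theorem setLIntegral_exp_le (hm : m ≤ mΩ) (h : CondSubGaussian μ m R ξ) (c : ℝ) {A : Set Ω}
    (hA : MeasurableSet[m] A) :
    ∫⁻ ω in A, ENNReal.ofReal (Real.exp (c * ξ ω - c ^ 2 * R ^ 2 / 2)) ∂μ ≤ μ A := by
  obtain ⟨hi, hle⟩ := h c
  have h1 : ∫ ω in A, Real.exp (c * ξ ω) ∂μ ≤ Real.exp (c ^ 2 * R ^ 2 / 2) * μ.real A := by
    rw [← setIntegral_condExp hm hi hA]
    calc ∫ ω in A, (μ[fun ω => Real.exp (c * ξ ω) | m]) ω ∂μ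
        ≤ ∫ _ in A, Real.exp (c ^ 2 * R ^ 2 / 2) ∂μ :=
          integral_mono_ae integrable_condExp.integrableOn (integrable_const _)
            (ae_restrict_of_ae hle)
      _ = _ := by simp [mul_comm]
  have h2 : (fun ω => Real.exp (c * ξ ω - c ^ 2 * R ^ 2 / 2)) =
      fun ω => Real.exp (-(c ^ 2 * R ^ 2 / 2)) * Real.exp (c * ξ ω) := by
    ext ω; rw [← Real.exp_add]; congr 1; ring
  rw [← ofReal_integral_eq_lintegral_ofReal, h2, integral_const_mul,
    ← ENNReal.ofReal_toReal (measure_ne_top μ A)]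
  · refine ENNReal.ofReal_le_ofReal ?_
    calc _ ≤ Real.exp (-(c ^ 2 * R ^ 2 / 2)) * (Real.exp (c ^ 2 * R ^ 2 / 2) * μ.real A) := by
          gcongr
      _ = μ.real A := by rw [← mul_assoc, ← Real.exp_add]; simp
  · rw [h2]; exact (hi.const_mul _).integrableOn
  · exact Filter.Eventually.of_forall fun _ => (Real.exp_pos _).le

theorem lintegral_mul_exp_const_le (hm : m ≤ mΩ) (h : CondSubGaussian μ m R ξ)
    (hξ : Measurable ξ) (c : ℝ) {W : Ω → ℝ≥0∞} (hW : Measurable[m] W) :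
    ∫⁻ ω, W ω * ENNReal.ofReal (Real.exp (c * ξ ω - c ^ 2 * R ^ 2 / 2)) ∂μ ≤ ∫⁻ ω, W ω ∂μ := by
  have hd : Measurable fun ω => ENNReal.ofReal (Real.exp (c * ξ ω - c ^ 2 * R ^ 2 / 2)) := by
    fun_prop
  have hle : (μ.withDensity fun ω =>
      ENNReal.ofReal (Real.exp (c * ξ ω - c ^ 2 * R ^ 2 / 2))).trim hm ≤ μ.trim hm := by
    refine Measure.le_iff.2 fun A hA => ?_
    rw [trim_measurableSet_eq hm hA, trim_measurableSet_eq hm hA, withDensity_apply _ (hm _ hA)]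
    exact setLIntegral_exp_le hm h c hA
  have := lintegral_mono' hle (le_refl W)
  rw [lintegral_trim hm hW, lintegral_trim hm hW,
    lintegral_withDensity_eq_lintegral_mul _ hd (hW.mono hm le_rfl)] at this
  simpa [mul_comm] using this

theorem lintegral_mul_exp_finite_range_le (hm : m ≤ mΩ) (h : CondSubGaussian μ m R ξ)
    (hξ : Measurable ξ) {g : Ω → ℝ} (hg : Measurable[m] g) {S : Finset ℝ} (hS : ∀ ω, g ω ∈ S)
    {W : Ω → ℝ≥0∞} (hW : Measurable[m] W) :
    ∫⁻ ω, W ω * ENNReal.ofReal (Real.exp (g ω * ξ ω - g ω ^ 2 * R ^ 2 / 2)) ∂μ ≤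
      ∫⁻ ω, W ω ∂μ := by
  have hdec (F : ℝ → Ω → ℝ≥0∞) (ω : Ω) :
      F (g ω) ω = ∑ c ∈ S, (g ⁻¹' {c}).indicator (F c) ω := by
    rw [Finset.sum_eq_single (g ω)]
    · simp
    · intro c _ hc
      exact Set.indicator_of_notMem (s := g ⁻¹' {c}) (fun h => hc (Eq.symm h)) _
    · intro hc
      exact absurd (hS ω) hc
  have hWs : ∀ c, Measurable[m] ((g ⁻¹' {c}).indicator W) := fun c =>
    hW.indicator (hg (measurableSet_singleton c))
  calc ∫⁻ ω, W ω * ENNReal.ofReal (Real.exp (g ω * ξ ω - g ω ^ 2 * R ^ 2 / 2)) ∂μ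
      = ∫⁻ ω, ∑ c ∈ S, (g ⁻¹' {c}).indicator W ω *
          ENNReal.ofReal (Real.exp (c * ξ ω - c ^ 2 * R ^ 2 / 2)) ∂μ := by
        refine lintegral_congr fun ω => ?_
        rw [hdec (fun c ω => W ω * ENNReal.ofReal (Real.exp (c * ξ ω - c ^ 2 * R ^ 2 / 2)))]
        refine Finset.sum_congr rfl fun c _ => ?_
        exact Set.indicator_mul_left _ _ _
    _ = ∑ c ∈ S, ∫⁻ ω, (g ⁻¹' {c}).indicator W ω *
          ENNReal.ofReal (Real.exp (c * ξ ω - c ^ 2 * R ^ 2 / 2)) ∂μ := by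
        refine lintegral_finsetSum _ fun c _ => ?_
        have := (hWs c).mono hm le_rfl
        fun_prop
    _ ≤ ∑ c ∈ S, ∫⁻ ω, (g ⁻¹' {c}).indicator W ω ∂μ :=
        Finset.sum_le_sum fun c _ => lintegral_mul_exp_const_le hm h hξ c (hWs c)
    _ = ∫⁻ ω, W ω ∂μ := by
        rw [← lintegral_finsetSum _ fun c _ => (hWs c).mono hm le_rfl]
        exact lintegral_congr fun ω => (hdec (fun _ => W) ω).symm

theorem exists_seq_finite_range_tendsto {α : Type*} [MeasurableSpace α] {g : α → ℝ}
    (hg : Measurable g) :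
    ∃ G : ℕ → α → ℝ, (∀ n, Measurable (G n)) ∧ (∀ n, ∃ S : Finset ℝ, ∀ x, G n x ∈ S) ∧
      ∀ x, Filter.Tendsto (fun n => G n x) Filter.atTop (nhds (g x)) :=
  ⟨fun n => hg.stronglyMeasurable.approx n, fun _ => SimpleFunc.measurable _,
    fun _ => ⟨_, SimpleFunc.mem_range_self _⟩, hg.stronglyMeasurable.tendsto_approx⟩

/-- The defining inequality of conditional sub-Gaussianity holds for random, predictable arguments
of the moment generating function: they are limits of simple functions, and Fatou's lemma
applies. -/
theorem lintegral_mul_exp_le (hm : m ≤ mΩ) (h : CondSubGaussian μ m R ξ)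
    (hξ : Measurable ξ) {g : Ω → ℝ} (hg : Measurable[m] g) {W : Ω → ℝ≥0∞} (hW : Measurable[m] W) :
    ∫⁻ ω, W ω * ENNReal.ofReal (Real.exp (g ω * ξ ω - g ω ^ 2 * R ^ 2 / 2)) ∂μ ≤
      ∫⁻ ω, W ω ∂μ := by
  have hW' : Measurable W := hW.mono hm le_rfl
  obtain ⟨G, hGm, hGr, hGlim⟩ :=
    @exists_seq_finite_range_tendsto Ω m g hg
  have hGmeas (n : ℕ) : Measurable (G n) := (hGm n).mono hm le_rfl
  have hsimple (n : ℕ) :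
      ∫⁻ ω, W ω * ENNReal.ofReal (Real.exp (G n ω * ξ ω - G n ω ^ 2 * R ^ 2 / 2)) ∂μ ≤
        ∫⁻ ω, W ω ∂μ := by
    obtain ⟨S, hS⟩ := hGr n
    exact lintegral_mul_exp_finite_range_le hm h hξ (hGm n) hS hW
  have hlim (ω : Ω) : Filter.Tendsto
      (fun n => W ω * ENNReal.ofReal (Real.exp (G n ω * ξ ω - G n ω ^ 2 * R ^ 2 / 2)))
      Filter.atTop
      (nhds (W ω * ENNReal.ofReal (Real.exp (g ω * ξ ω - g ω ^ 2 * R ^ 2 / 2)))) := by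
    have h1 := hGlim ω
    have hc : Continuous fun r : ℝ =>
      ENNReal.ofReal (Real.exp (r * ξ ω - r ^ 2 * R ^ 2 / 2)) :=
      ENNReal.continuous_ofReal.comp (by fun_prop)
    have h2 := (hc.tendsto (g ω)).comp h1
    refine ENNReal.Tendsto.const_mul h2 (Or.inl ?_)
    simp [Real.exp_pos]
  calc _ = ∫⁻ ω, Filter.liminf (fun n => W ω *
          ENNReal.ofReal (Real.exp (G n ω * ξ ω - G n ω ^ 2 * R ^ 2 / 2))) Filter.atTop ∂μ :=
        lintegral_congr fun ω => ((hlim ω).liminf_eq).symm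
    _ ≤ Filter.liminf (fun n => ∫⁻ ω, W ω *
          ENNReal.ofReal (Real.exp (G n ω * ξ ω - G n ω ^ 2 * R ^ 2 / 2)) ∂μ) Filter.atTop := by
        refine lintegral_liminf_le fun n => ?_
        have := hGmeas n
        fun_prop
    _ ≤ Filter.liminf (fun _ : ℕ => ∫⁻ ω, W ω ∂μ) Filter.atTop :=
        Filter.liminf_le_liminf (Filter.Eventually.of_forall hsimple)
    _ = _ := Filter.liminf_const _

/-- The average of the likelihood ratio `exp (g u - g² / 2)` over `g` with the normal law of mean
`a` and variance `s²`. -/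
theorem lintegral_gaussian_mixture (s a u : ℝ) :
    ∫⁻ z, ENNReal.ofReal (gaussianPDFReal 0 1 z *
        Real.exp ((a + s * z) * u - (a + s * z) ^ 2 / 2)) =
      ENNReal.ofReal ((√(1 + s ^ 2))⁻¹ *
        Real.exp ((s ^ 2 * u ^ 2 + 2 * u * a - a ^ 2) / (2 * (1 + s ^ 2)))) := by
  have hV : 0 < 1 + s ^ 2 := by positivity
  set v : NNReal := ⟨(1 + s ^ 2)⁻¹, by positivity⟩ with hv
  have hv0 : v ≠ 0 := by
    rw [Ne, ← NNReal.coe_eq_zero]; exact inv_ne_zero hV.ne'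
  -- completing the square turns the integrand into a multiple of another normal density
  have key (z : ℝ) : gaussianPDFReal 0 1 z *
        Real.exp ((a + s * z) * u - (a + s * z) ^ 2 / 2) =
      ((√(1 + s ^ 2))⁻¹ *
        Real.exp ((s ^ 2 * u ^ 2 + 2 * u * a - a ^ 2) / (2 * (1 + s ^ 2)))) *
        gaussianPDFReal (s * (u - a) / (1 + s ^ 2)) v z := by
    have hv' : (v : ℝ) = (1 + s ^ 2)⁻¹ := rfl
    simp only [gaussianPDFReal, hv', NNReal.coe_one, mul_one, sub_zero]
    have e1 : √(2 * Real.pi * (1 + s ^ 2)⁻¹) = √(2 * Real.pi) * (√(1 + s ^ 2))⁻¹ := by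
      rw [Real.sqrt_mul (by positivity), Real.sqrt_inv]
    have e2 : √(1 + s ^ 2) ≠ 0 := (Real.sqrt_pos.2 hV).ne'
    have e3 : √(2 * Real.pi) ≠ 0 := (Real.sqrt_pos.2 (by positivity)).ne'
    rw [e1, mul_assoc, ← Real.exp_add]
    have e4 : (√(1 + s ^ 2))⁻¹ *
        Real.exp ((s ^ 2 * u ^ 2 + 2 * u * a - a ^ 2) / (2 * (1 + s ^ 2))) *
        ((√(2 * Real.pi) * (√(1 + s ^ 2))⁻¹)⁻¹ *
          Real.exp (-(z - s * (u - a) / (1 + s ^ 2)) ^ 2 / (2 * (1 + s ^ 2)⁻¹))) =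
        (√(2 * Real.pi))⁻¹ * Real.exp ((s ^ 2 * u ^ 2 + 2 * u * a - a ^ 2) / (2 * (1 + s ^ 2)) +
          -(z - s * (u - a) / (1 + s ^ 2)) ^ 2 / (2 * (1 + s ^ 2)⁻¹)) := by
      rw [Real.exp_add]; field_simp
    rw [e4]
    congr 2
    field_simp
    ring
  simp_rw [key]
  have hpos : 0 ≤ (√(1 + s ^ 2))⁻¹ *
        Real.exp ((s ^ 2 * u ^ 2 + 2 * u * a - a ^ 2) / (2 * (1 + s ^ 2))) := by positivity
  simp_rw [ENNReal.ofReal_mul hpos]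
  rw [lintegral_const_mul _ (by fun_prop), lintegral_gaussianPDFReal_eq_one _ hv0, mul_one]

/-- The mixture of the exponential supermartingale over a predictable normal law of mean `a` and
variance `v` is again a supermartingale factor. -/
theorem lintegral_mul_mixture_le (hm : m ≤ mΩ) (hR : 0 < R) (h : CondSubGaussian μ m R ξ)
    (hξ : Measurable ξ) {a v : Ω → ℝ} (ha : Measurable[m] a) (hv : Measurable[m] v)
    (hv0 : ∀ ω, 0 ≤ v ω) {W : Ω → ℝ≥0∞} (hW : Measurable[m] W) :
    ∫⁻ ω, W ω * ENNReal.ofReal ((√(1 + v ω))⁻¹ *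
        Real.exp ((v ω * (ξ ω / R) ^ 2 + 2 * (ξ ω / R) * a ω - a ω ^ 2) / (2 * (1 + v ω)))) ∂μ ≤
      ∫⁻ ω, W ω ∂μ := by
  have hW' : Measurable W := hW.mono hm le_rfl
  have ha' : Measurable a := ha.mono hm le_rfl
  have hv' : Measurable v := hv.mono hm le_rfl
  have hpdf : Measurable (gaussianPDFReal 0 1) := by fun_prop
  have e1 (ω : Ω) : ENNReal.ofReal ((√(1 + v ω))⁻¹ *
        Real.exp ((v ω * (ξ ω / R) ^ 2 + 2 * (ξ ω / R) * a ω - a ω ^ 2) / (2 * (1 + v ω)))) =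
      ∫⁻ z, ENNReal.ofReal (gaussianPDFReal 0 1 z) * ENNReal.ofReal
        (Real.exp ((a ω + √(v ω) * z) * (ξ ω / R) - (a ω + √(v ω) * z) ^ 2 / 2)) := by
    have := lintegral_gaussian_mixture (√(v ω)) (a ω) (ξ ω / R)
    rw [Real.sq_sqrt (hv0 ω)] at this
    rw [← this]
    exact lintegral_congr fun z => ENNReal.ofReal_mul (gaussianPDFReal_nonneg _ _ _)
  simp_rw [e1]
  calc _ = ∫⁻ ω, (∫⁻ z : ℝ, W ω * (ENNReal.ofReal (gaussianPDFReal 0 1 z) * ENNReal.ofReal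
        (Real.exp ((a ω + √(v ω) * z) * (ξ ω / R) - (a ω + √(v ω) * z) ^ 2 / 2)))) ∂μ := by
        refine lintegral_congr fun ω => ?_
        rw [lintegral_const_mul]
        fun_prop
    _ = ∫⁻ z : ℝ, ∫⁻ ω, W ω * (ENNReal.ofReal (gaussianPDFReal 0 1 z) * ENNReal.ofReal
        (Real.exp ((a ω + √(v ω) * z) * (ξ ω / R) - (a ω + √(v ω) * z) ^ 2 / 2))) ∂μ := by
        refine lintegral_lintegral_swap (Measurable.aemeasurable ?_)
        simp only [Function.uncurry_def]
        fun_prop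
    _ ≤ ∫⁻ z : ℝ, ENNReal.ofReal (gaussianPDFReal 0 1 z) * ∫⁻ ω, W ω ∂μ := by
        refine lintegral_mono fun z => ?_
        have hg : Measurable[m] fun ω => (a ω + √(v ω) * z) / R := by fun_prop
        have h1 := lintegral_mul_exp_le hm h hξ hg hW
        calc _ = ∫⁻ ω, ENNReal.ofReal (gaussianPDFReal 0 1 z) * (W ω * ENNReal.ofReal (Real.exp
              ((a ω + √(v ω) * z) / R * ξ ω - ((a ω + √(v ω) * z) / R) ^ 2 * R ^ 2 / 2))) ∂μ := by
              refine lintegral_congr fun ω => ?_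
              rw [mul_left_comm]
              congr 4
              field_simp
          _ = ENNReal.ofReal (gaussianPDFReal 0 1 z) * ∫⁻ ω, W ω * ENNReal.ofReal (Real.exp
              ((a ω + √(v ω) * z) / R * ξ ω - ((a ω + √(v ω) * z) / R) ^ 2 * R ^ 2 / 2)) ∂μ := by
              refine lintegral_const_mul _ ?_
              fun_prop
          _ ≤ _ := by gcongr
    _ = ∫⁻ ω, W ω ∂μ := by
        rw [lintegral_mul_const _ (by fun_prop), lintegral_gaussianPDFReal_eq_one _ one_ne_zero,
          one_mul]

theorem CondSubGaussian.ae_eq_zero (hm : m ≤ mΩ) (h : CondSubGaussian μ m 0 ξ) :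
    ξ =ᵐ[μ] 0 := by
  have hle (c : ℝ) : ∫ ω, Real.exp (c * ξ ω) ∂μ ≤ 1 := by
    obtain ⟨hi, hle⟩ := h c
    rw [← integral_condExp hm]
    calc _ ≤ ∫ _, Real.exp (c ^ 2 * 0 ^ 2 / 2) ∂μ :=
          integral_mono_ae integrable_condExp (integrable_const _) hle
      _ = 1 := by simp
  have hnn : 0 ≤ fun ω => Real.exp (1 * ξ ω) + Real.exp (-1 * ξ ω) - 2 := by
    intro ω
    have := Real.add_one_le_exp (1 * ξ ω)
    have := Real.add_one_le_exp (-1 * ξ ω)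
    simp only [Pi.zero_apply]; linarith
  have hi := (((h 1).1.add (h (-1)).1).sub (integrable_const (2 : ℝ)))
  have h0 : ∫ ω, (Real.exp (1 * ξ ω) + Real.exp (-1 * ξ ω) - 2) ∂μ = 0 := by
    refine le_antisymm ?_ (integral_nonneg hnn)
    have := hle 1
    have := hle (-1)
    have e : ∫ ω, (Real.exp (1 * ξ ω) + Real.exp (-1 * ξ ω) - 2) ∂μ =
        ∫ ω, Real.exp (1 * ξ ω) ∂μ + ∫ ω, Real.exp (-1 * ξ ω) ∂μ - 2 := by
      rw [integral_sub (f := fun ω => Real.exp (1 * ξ ω) + Real.exp (-1 * ξ ω))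
        ((h 1).1.add (h (-1)).1) (integrable_const _), integral_add (h 1).1 (h (-1)).1]
      simp
    linarith
  have hae := (integral_eq_zero_iff_of_nonneg hnn hi).1 h0
  filter_upwards [hae] with ω hω
  by_contra hne
  have h1 := Real.add_one_lt_exp (x := 1 * ξ ω) (by simpa using hne)
  have h2 := Real.add_one_lt_exp (x := -1 * ξ ω) (by simpa using hne)
  simp only [Pi.zero_apply] at hω
  linarith

end SubGaussian

/-! ### Measurability of the posterior -/

section Measurability

variable {Ω X ι : Type*} [Fintype ι] [MeasurableSpace Ω] [MeasurableSpace X]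
  {k : X → X → ℝ} {lam : ℝ}

theorem measurable_dotProduct_mulVec {A : Ω → Matrix ι ι ℝ} {u v : Ω → ι → ℝ}
    (hA : ∀ i j, Measurable fun ω => A ω i j) (hu : ∀ i, Measurable fun ω => u ω i)
    (hv : ∀ i, Measurable fun ω => v ω i) : Measurable fun ω => u ω ⬝ᵥ (A ω *ᵥ v ω) := by
  simp only [dotProduct, mulVec]
  fun_prop

variable [DecidableEq ι]

theorem measurable_matrix_det {A : Ω → Matrix ι ι ℝ} (hA : ∀ i j, Measurable fun ω => A ω i j) :
    Measurable fun ω => (A ω).det := by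
  simp only [det_apply]
  fun_prop

theorem measurable_matrix_inv_apply {A : Ω → Matrix ι ι ℝ}
    (hA : ∀ i j, Measurable fun ω => A ω i j) (i j : ι) : Measurable fun ω => (A ω)⁻¹ i j := by
  simp only [inv_def, Ring.inverse_eq_inv', Matrix.smul_apply, smul_eq_mul, adjugate_apply]
  refine (measurable_matrix_det hA).inv.mul (measurable_matrix_det fun a b => ?_)
  by_cases h : a = j
  · subst h; simp
  · simpa [updateRow_ne h] using hA a b

variable {p : Ω → ι → X} {u : Ω → ι → ℝ} {z : Ω → X}

theorem measurable_ridge_inv (hk : Measurable fun q : X × X => k q.1 q.2)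
    (hp : ∀ i, Measurable fun ω => p ω i) (i j : ι) :
    Measurable fun ω => (kernelMatrix k (p ω) + lam • (1 : Matrix ι ι ℝ))⁻¹ i j := by
  refine measurable_matrix_inv_apply (fun i j => ?_) i j
  simp only [Matrix.add_apply, kernelMatrix, of_apply]
  exact (hk.comp ((hp i).prodMk (hp j))).add_const _

theorem measurable_infoDet (hk : Measurable fun q : X × X => k q.1 q.2)
    (hp : ∀ i, Measurable fun ω => p ω i) : Measurable fun ω => infoDet k lam (p ω) := by
  refine measurable_matrix_det fun i j => ?_
  simp only [Matrix.add_apply, Matrix.smul_apply, kernelMatrix, of_apply]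
  exact ((hk.comp ((hp i).prodMk (hp j))).const_mul _).const_add _

theorem measurable_noiseForm (hk : Measurable fun q : X × X => k q.1 q.2)
    (hp : ∀ i, Measurable fun ω => p ω i) (hu : ∀ i, Measurable fun ω => u ω i) :
    Measurable fun ω => noiseForm k lam (p ω) (u ω) := by
  refine Measurable.sub ?_
    ((measurable_dotProduct_mulVec (measurable_ridge_inv hk hp) hu hu).const_mul _)
  simp only [dotProduct]
  fun_prop

theorem measurable_postMean (hk : Measurable fun q : X × X => k q.1 q.2)
    (hp : ∀ i, Measurable fun ω => p ω i) (hu : ∀ i, Measurable fun ω => u ω i)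
    (hz : Measurable z) : Measurable fun ω => postMean k lam (p ω) (u ω) (z ω) :=
  measurable_dotProduct_mulVec (measurable_ridge_inv hk hp)
    (fun i => hk.comp ((hp i).prodMk hz)) hu

theorem measurable_postCov (hk : Measurable fun q : X × X => k q.1 q.2)
    (hp : ∀ i, Measurable fun ω => p ω i) (hz : Measurable z) :
    Measurable fun ω => postCov k lam (p ω) (z ω) (z ω) :=
  (hk.comp (hz.prodMk hz)).sub (measurable_dotProduct_mulVec (measurable_ridge_inv hk hp)
    (fun i => hk.comp ((hp i).prodMk hz)) (fun i => hk.comp ((hp i).prodMk hz)))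

end Measurability

/-! ### The self-normalized deviation bound -/

section Concentration

open scoped ENNReal

variable {Ω X H : Type*} {mΩ : MeasurableSpace Ω} {μ : Measure Ω} [IsProbabilityMeasure μ]
  [NormedAddCommGroup H] [InnerProductSpace ℝ H]
  {k : X → X → ℝ} {lam R : ℝ} {φ : X → H}

/-- The likelihood ratio of the noise `u` on the rounds `s`, averaged over a centred Gaussian
process with covariance `k / lam`, in closed form. -/
noncomputable def mixture (k : X → X → ℝ) (lam R : ℝ) (x : ℕ → X) (u : ℕ → ℝ) (s : Finset ℕ) : ℝ :=
  (√(infoDet k lam (fun i : s => x i)))⁻¹ *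
    Real.exp (noiseForm k lam (fun i : s => x i) (fun i => u i) / (2 * R ^ 2))

theorem mixture_insert (hk : ∀ x y, k x y = inner ℝ (φ x) (φ y)) (hlam : 0 < lam) (hR : 0 < R)
    (hk1 : ∀ x, k x x ≤ 1) (x : ℕ → X) (u : ℕ → ℝ) {s : Finset ℕ} {b : ℕ} (hb : b ∉ s)
    {a v : ℝ} (ha : a = postMean k lam (fun i : s => x i) (fun i => u i) (x b) / R)
    (hv : v = postCov k lam (fun i : s => x i) (x b) (x b) / lam) :
    mixture k lam R x u (insert b s) = mixture k lam R x u s * ((√(1 + v))⁻¹ *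
      Real.exp ((v * (u b / R) ^ 2 + 2 * (u b / R) * a - a ^ 2) / (2 * (1 + v)))) := by
  have hv0 : 0 ≤ v := hv ▸ div_nonneg (postCov_self_nonneg hk hlam _ _) hlam.le
  have hL : 1 ≤ infoDet k lam (fun i : s => x i) := (infoDet_mem_Icc hk hlam hk1 _).1
  rw [mixture, mixture, infoDet_insert hk hlam x s hb, noiseForm_insert hk hlam x u s hb, ← hv,
    Real.sqrt_mul (by linarith), mul_inv]
  have ha' : postMean k lam (fun i : s => x i) (fun i => u i) (x b) = a * R := by
    rw [ha]; field_simp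
  have hv' : postCov k lam (fun i : s => x i) (x b) (x b) = v * lam := by
    rw [hv]; field_simp
  rw [ha', hv']
  have e : (noiseForm k lam (fun i : s => x i) (fun i => u i) +
      (u b ^ 2 - lam * (u b - a * R) ^ 2 / (lam + v * lam))) / (2 * R ^ 2) =
      noiseForm k lam (fun i : s => x i) (fun i => u i) / (2 * R ^ 2) +
      (v * (u b / R) ^ 2 + 2 * (u b / R) * a - a ^ 2) / (2 * (1 + v)) := by
    rw [add_div]
    congr 1
    have : lam + v * lam = lam * (1 + v) := by ring
    rw [this]
    have : 1 + v ≠ 0 := by positivity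
    field_simp
    ring
  rw [e, Real.exp_add]
  ring

variable [MeasurableSpace X]

theorem measurable_mixture {m : MeasurableSpace Ω} (hkm : Measurable fun q : X × X => k q.1 q.2)
    {x : ℕ → Ω → X} {u : ℕ → Ω → ℝ} {s : Finset ℕ} (hx : ∀ i ∈ s, Measurable (x i))
    (hu : ∀ i ∈ s, Measurable (u i)) :
    Measurable fun ω => mixture k lam R (fun i => x i ω) (fun i => u i ω) s := by
  have h1 : Measurable fun ω => infoDet k lam (fun i : s => x i ω) :=
    measurable_infoDet hkm fun i => hx i i.2
  have h2 : Measurable fun ω => noiseForm k lam (fun i : s => x i ω) (fun i => u i ω) :=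
    measurable_noiseForm hkm (fun i => hx i i.2) (fun i => hu i i.2)
  unfold mixture
  fun_prop

theorem measurable_mixture_mean {m : MeasurableSpace Ω}
    (hkm : Measurable fun q : X × X => k q.1 q.2)
    {x : ℕ → Ω → X} {u : ℕ → Ω → ℝ} {s : Finset ℕ} {b : ℕ} (hx : ∀ i ∈ s, Measurable (x i))
    (hu : ∀ i ∈ s, Measurable (u i)) (hb : Measurable (x b)) :
    Measurable fun ω => postMean k lam (fun i : s => x i ω) (fun i => u i ω) (x b ω) / R :=
  (measurable_postMean (ι := s) hkm (fun i => hx i i.2) (fun i => hu i i.2) hb).div_const R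

theorem measurable_mixture_variance {m : MeasurableSpace Ω}
    (hkm : Measurable fun q : X × X => k q.1 q.2)
    {x : ℕ → Ω → X} {s : Finset ℕ} {b : ℕ} (hx : ∀ i ∈ s, Measurable (x i))
    (hb : Measurable (x b)) :
    Measurable fun ω => postCov k lam (fun i : s => x i ω) (x b ω) (x b ω) / lam :=
  (measurable_postCov (ι := s) hkm (fun i => hx i i.2) hb).div_const lam

/-- The mixture is a nonnegative supermartingale started at `1`. -/
theorem lintegral_mixture_le_one (hk : ∀ x y, k x y = inner ℝ (φ x) (φ y)) (hlam : 0 < lam)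
    (hk1 : ∀ x, k x x ≤ 1) (hkm : Measurable fun q : X × X => k q.1 q.2) (hR : 0 < R)
    {x : ℕ → Ω → X} {u : ℕ → Ω → ℝ} {F : ℕ → MeasurableSpace Ω} {a b : ℕ} (hab : a ≤ b)
    (hF : ∀ t, a ≤ t → t < b → F t ≤ mΩ)
    (hx : ∀ s t, a ≤ s → s ≤ t → t < b → Measurable[F t] (x s))
    (hu : ∀ s t, a ≤ s → s < t → t < b → Measurable[F t] (u s))
    (hum : ∀ t, a ≤ t → t < b → Measurable (u t))
    (hsub : ∀ t, a ≤ t → t < b → CondSubGaussian μ (F t) R (u t)) :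
    ∫⁻ ω, ENNReal.ofReal (mixture k lam R (fun i => x i ω) (fun i => u i ω) (Finset.Ico a b)) ∂μ
      ≤ 1 := by
  induction b, hab using Nat.le_induction with
  | base =>
    have (x : ℕ → X) (u : ℕ → ℝ) : mixture k lam R x u ∅ = 1 := by
      simp [mixture, infoDet, noiseForm]
    simp [this]
  | succ b hab ih =>
    refine le_trans ?_ (ih (fun t h1 h2 => hF t h1 (by omega))
      (fun s t h1 h2 h3 => hx s t h1 h2 (by omega)) (fun s t h1 h2 h3 => hu s t h1 h2 (by omega))
      (fun t h1 h2 => hum t h1 (by omega)) (fun t h1 h2 => hsub t h1 (by omega)))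
    have hxb : ∀ i ∈ Finset.Ico a b, Measurable[F b] (x i) := fun i hi => by
      rw [Finset.mem_Ico] at hi; exact hx i b hi.1 hi.2.le (by omega)
    have hub : ∀ i ∈ Finset.Ico a b, Measurable[F b] (u i) := fun i hi => by
      rw [Finset.mem_Ico] at hi; exact hu i b hi.1 hi.2 (by omega)
    have hxbb : Measurable[F b] (x b) := hx b b hab le_rfl (by omega)
    have hstep := lintegral_mul_mixture_le (W := fun ω => ENNReal.ofReal
        (mixture k lam R (fun i => x i ω) (fun i => u i ω) (Finset.Ico a b)))
      (a := fun ω => postMean k lam (fun i : Finset.Ico a b => x i ω) (fun i => u i ω) (x b ω) / R)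
      (v := fun ω => postCov k lam (fun i : Finset.Ico a b => x i ω) (x b ω) (x b ω) / lam)
      (hF b hab (by omega)) hR (hsub b hab (by omega)) (hum b hab (by omega))
      (measurable_mixture_mean hkm hxb hub hxbb) (measurable_mixture_variance hkm hxb hxbb)
      (fun ω => div_nonneg (postCov_self_nonneg hk hlam _ _) hlam.le)
      (@Measurable.ennreal_ofReal _ (F b) _ (measurable_mixture hkm hxb hub))
    refine le_trans (le_of_eq (lintegral_congr fun ω => ?_)) hstep
    have hins : Finset.Ico a (b + 1) = insert b (Finset.Ico a b) := by
      ext i; simp only [Finset.mem_Ico, Finset.mem_insert]; omega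
    rw [hins, mixture_insert hk hlam hR hk1 _ _ (by simp) rfl rfl, ENNReal.ofReal_mul]
    unfold mixture
    positivity

/-- The self-normalized bound at a fixed time: outside an event of probability `ε`, the noise
quadratic form is at most `R² (ln |I + lam⁻¹ K| + 2 ln (1 / ε))`. -/
theorem measure_noiseForm_gt_le (hk : ∀ x y, k x y = inner ℝ (φ x) (φ y)) (hlam : 0 < lam)
    (hk1 : ∀ x, k x x ≤ 1) (hkm : Measurable fun q : X × X => k q.1 q.2) (hR : 0 ≤ R)
    {x : ℕ → Ω → X} {u : ℕ → Ω → ℝ} {F : ℕ → MeasurableSpace Ω} {a b : ℕ} (hab : a ≤ b)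
    (hF : ∀ t, a ≤ t → t < b → F t ≤ mΩ)
    (hx : ∀ s t, a ≤ s → s ≤ t → t < b → Measurable[F t] (x s))
    (hu : ∀ s t, a ≤ s → s < t → t < b → Measurable[F t] (u s))
    (hum : ∀ t, a ≤ t → t < b → Measurable (u t))
    (hsub : ∀ t, a ≤ t → t < b → CondSubGaussian μ (F t) R (u t)) {ε : ℝ} (hε : 0 < ε) :
    μ {ω | R ^ 2 * (Real.log (infoDet k lam (fun i : Finset.Ico a b => x i ω)) +
        2 * Real.log (1 / ε)) <
      noiseForm k lam (fun i : Finset.Ico a b => x i ω) (fun i => u i ω)} ≤ ENNReal.ofReal ε := by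
  rcases hR.eq_or_lt with rfl | hR
  · refine le_trans (le_of_eq ?_) zero_le
    have h0 : ∀ᵐ ω ∂μ, ∀ i : Finset.Ico a b, u i ω = 0 := by
      refine ae_all_iff.2 fun i => ?_
      obtain ⟨i, hi⟩ := i
      rw [Finset.mem_Ico] at hi
      exact (hsub i hi.1 hi.2).ae_eq_zero (hF i hi.1 hi.2)
    rw [measure_eq_zero_iff_ae_notMem]
    filter_upwards [h0] with ω hω
    have : (fun i : Finset.Ico a b => u i ω) = 0 := funext hω
    simp [this, noiseForm]
  · have hxm : ∀ i ∈ Finset.Ico a b, Measurable (x i) := fun i hi => by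
      rw [Finset.mem_Ico] at hi
      exact (hx i i hi.1 le_rfl hi.2).mono (hF i hi.1 hi.2) le_rfl
    have hmm : Measurable fun ω => ENNReal.ofReal
        (mixture k lam R (fun i => x i ω) (fun i => u i ω) (Finset.Ico a b)) :=
      (measurable_mixture hkm hxm fun i hi => by
        rw [Finset.mem_Ico] at hi; exact hum i hi.1 hi.2).ennreal_ofReal
    have hmarkov := meas_ge_le_lintegral_div hmm.aemeasurable (μ := μ)
      (ε := ENNReal.ofReal (1 / ε)) (by simpa using hε) ENNReal.ofReal_ne_top
    have hone := lintegral_mixture_le_one hk hlam hk1 hkm hR hab hF hx hu hum hsub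
    calc _ ≤ μ {ω | ENNReal.ofReal (1 / ε) ≤ ENNReal.ofReal
          (mixture k lam R (fun i => x i ω) (fun i => u i ω) (Finset.Ico a b))} := by
          refine measure_mono fun ω hω => ENNReal.ofReal_le_ofReal ?_
          simp only [Set.mem_ofPred_eq] at hω
          have hL : 0 < infoDet k lam (fun i : Finset.Ico a b => x i ω) :=
            zero_lt_one.trans_le (infoDet_mem_Icc hk hlam hk1 _).1
          have h1ε : 0 < 1 / ε := by positivity
          rw [mixture]
          set L := infoDet k lam (fun i : Finset.Ico a b => x i ω)
          set Q := noiseForm k lam (fun i : Finset.Ico a b => x i ω) (fun i => u i ω)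
          have e1 : (√L)⁻¹ = Real.exp (-(Real.log L / 2)) := by
            rw [Real.exp_neg, ← Real.log_sqrt hL.le, Real.exp_log (Real.sqrt_pos.2 hL)]
          rw [e1, ← Real.exp_add, ← Real.exp_log h1ε]
          refine Real.exp_le_exp.2 ?_
          have : (Real.log L + 2 * Real.log (1 / ε)) / 2 ≤ Q / (2 * R ^ 2) := by
            rw [div_le_div_iff₀ (by norm_num) (by positivity)]
            linarith
          linarith
      _ ≤ _ := hmarkov
      _ ≤ 1 / ENNReal.ofReal (1 / ε) := by gcongr
      _ = ENNReal.ofReal ε := by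
          rw [one_div, one_div, ENNReal.ofReal_inv_of_pos hε, inv_inv]

end Concentration

/-! ### Sliding windows: drift, confidence and cumulative variance -/

section Windows

/-- Functions of rounds in a common window differ by at most the variation inside the window. -/
theorem norm_sub_le_sum_window {H : Type*} [NormedAddCommGroup H] (f : ℕ → H) {w t s : ℕ}
    (hs : s ∈ window w t) :
    ‖f s - f t‖ ≤ ∑ r ∈ window w t, ‖f (r + 1) - f r‖ := by
  rw [window, Finset.mem_Ico] at hs
  rw [← dist_eq_norm]
  refine (dist_le_Ico_sum_dist f hs.2.le).trans ?_
  simp only [dist_eq_norm']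
  exact Finset.sum_le_sum_of_subset_of_nonneg (Finset.Ico_subset_Ico_left hs.1)
    fun _ _ _ => norm_nonneg _

variable {X H : Type*} [NormedAddCommGroup H] [InnerProductSpace ℝ H]
  {k : X → X → ℝ} {lam : ℝ} {φ : X → H}

theorem card_window_le (w t : ℕ) : (window w t).card ≤ min t w := by
  rw [window, Nat.card_Ico]; omega

/-- Each round lies in at most `w` windows. -/
theorem sum_sum_window_le {g : ℕ → ℝ} (hg : ∀ r, 0 ≤ g r) (w T : ℕ) :
    ∑ t ∈ Finset.Icc 2 T, ∑ r ∈ window w t, g r ≤ w * ∑ r ∈ Finset.Ico 1 T, g r := by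
  rw [Finset.sum_comm' (t' := Finset.Ico 1 T) (s' := fun r => Finset.Icc (r + 1) (min T (r + w)))]
  · rw [Finset.mul_sum]
    refine Finset.sum_le_sum fun r _ => ?_
    rw [Finset.sum_const, nsmul_eq_mul]
    refine mul_le_mul_of_nonneg_right ?_ (hg r)
    rw [Nat.card_Icc]
    exact_mod_cast (by omega : min T (r + w) + 1 - (r + 1) ≤ w)
  · intro t r
    simp only [window, Finset.mem_Icc, Finset.mem_Ico]
    omega

theorem abs_dotProduct_le_of_abs_le {ι : Type*} [Fintype ι] {a d : ι → ℝ} {A D : ℝ} {w : ℕ}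
    (hA : a ⬝ᵥ a ≤ A) (hD0 : 0 ≤ D) (hd : ∀ i, |d i| ≤ D) (hw : Fintype.card ι ≤ w) :
    |a ⬝ᵥ d| ≤ √A * √w * D := by
  have cs : (a ⬝ᵥ d) ^ 2 ≤ (a ⬝ᵥ a) * (d ⬝ᵥ d) := by
    simpa [dotProduct, pow_two] using Finset.sum_mul_sq_le_sq_mul_sq Finset.univ a d
  have ha0 : 0 ≤ a ⬝ᵥ a := by simpa using dotProduct_star_self_nonneg a
  have hd2 : d ⬝ᵥ d ≤ w * D ^ 2 := by
    calc d ⬝ᵥ d ≤ ∑ _ : ι, D ^ 2 := by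
          refine Finset.sum_le_sum fun i _ => ?_
          rw [← pow_two, ← sq_abs]
          exact pow_le_pow_left₀ (abs_nonneg _) (hd i) 2
      _ = Fintype.card ι * D ^ 2 := by simp
      _ ≤ w * D ^ 2 := by gcongr
  have hA0 : 0 ≤ A := ha0.trans hA
  have : √A * √w * D = √(A * (w * D ^ 2)) := by
    rw [Real.sqrt_mul hA0, Real.sqrt_mul (Nat.cast_nonneg w), Real.sqrt_sq hD0, mul_assoc]
  rw [this]
  refine Real.abs_le_sqrt (cs.trans ?_)
  have : 0 ≤ d ⬝ᵥ d := by simpa using dotProduct_star_self_nonneg d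
  gcongr

/-- The confidence band: the error of the sliding-window posterior mean splits into the bias of
ridge regression, the noise, and the drift of the reward functions inside the window. -/
theorem abs_swMean_sub_le (hk : ∀ x y, k x y = inner ℝ (φ x) (φ y)) (hlam : 0 < lam)
    (hk1 : ∀ x, k x x ≤ 1) {κ : ℝ} (hκ : ∀ x, k x x ≤ κ) {B c : ℝ} {w t : ℕ}
    {f : ℕ → H} (hf : ‖f t‖ ≤ B) {x : ℕ → X} {y η : ℕ → ℝ}
    (hy : ∀ s, y s = inner ℝ (φ (x s)) (f s) + η s)
    (hη : noiseForm k lam (fun s : window w t => x s) (fun s => η s) ≤ c) (z : X) :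
    |swMean k lam w x y t z - inner ℝ (φ z) (f t)| ≤
      (B + √(c / lam)) * swStd k lam w x t z +
        √(κ / lam) * √w * ∑ r ∈ window w t, ‖f (r + 1) - f r‖ := by
  set p : window w t → X := fun s => x s
  set a := weights k lam p z with ha
  set D := ∑ r ∈ window w t, ‖f (r + 1) - f r‖
  have hD0 : 0 ≤ D := Finset.sum_nonneg fun _ _ => norm_nonneg _
  have hsplit : swMean k lam w x y t z - inner ℝ (φ z) (f t) =
      (a ⬝ᵥ (fun i => inner ℝ (φ (p i)) (f t)) - inner ℝ (φ z) (f t)) +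
        a ⬝ᵥ (fun s : window w t => η s) +
          a ⬝ᵥ (fun s : window w t => inner ℝ (φ (x s)) (f s - f t)) := by
    have hyv : (fun s : window w t => y s) = (fun i => inner ℝ (φ (p i)) (f t)) +
        (fun s : window w t => η s) +
          (fun s : window w t => inner ℝ (φ (x s)) (f s - f t)) := by
      ext s
      simp only [Pi.add_apply, hy, inner_sub_right, p]
      ring
    rw [swMean, postMean_eq hk, hyv, dotProduct_add, dotProduct_add]
    ring
  have h1 := abs_bias_le hk hlam p z (f t)
  have h2 := abs_weights_dotProduct_le hk hlam p z (fun s : window w t => η s) hη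
  have h3 : |a ⬝ᵥ (fun s : window w t => inner ℝ (φ (x s)) (f s - f t))| ≤
      √(κ / lam) * √w * D := by
    refine abs_dotProduct_le_of_abs_le ((weights_sq_le hk hlam p z).trans ?_) hD0 (fun s => ?_) ?_
    · gcongr; exact hκ z
    · refine (abs_real_inner_le_norm _ _).trans ?_
      have hn : ‖φ (x s)‖ ≤ 1 := by
        have := hk1 (x s)
        rw [hk, real_inner_self_eq_norm_sq] at this
        nlinarith [norm_nonneg (φ (x s))]
      calc _ ≤ 1 * D := by
            gcongr
            exact norm_sub_le_sum_window f s.2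
        _ = D := one_mul D
    · rw [Fintype.card_coe]; exact (card_window_le w t).trans (min_le_right _ _)
  have hstd : 0 ≤ postStd k lam p z := Real.sqrt_nonneg _
  have h4 : ‖f t‖ * postStd k lam p z ≤ B * postStd k lam p z := by gcongr
  rw [hsplit]
  calc _ ≤ |a ⬝ᵥ (fun i => inner ℝ (φ (p i)) (f t)) - inner ℝ (φ z) (f t)| +
        |a ⬝ᵥ (fun s : window w t => η s)| +
          |a ⬝ᵥ (fun s : window w t => inner ℝ (φ (x s)) (f s - f t))| := abs_add_three _ _ _
    _ ≤ B * postStd k lam p z + postStd k lam p z * √(c / lam) + √(κ / lam) * √w * D := by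
        gcongr
        exact h1.trans h4
    _ = _ := by rw [swStd]; ring

/-- The chain rule for the information gain. -/
theorem sum_log_one_add_postCov (hk : ∀ x y, k x y = inner ℝ (φ x) (φ y)) (hlam : 0 < lam)
    (hk1 : ∀ x, k x x ≤ 1) (x : ℕ → X) {a b : ℕ} (hab : a ≤ b) :
    ∑ t ∈ Finset.Ico a b,
        Real.log (1 + postCov k lam (fun s : Finset.Ico a t => x s) (x t) (x t) / lam) =
      Real.log (infoDet k lam (fun s : Finset.Ico a b => x s)) := by
  induction b, hab using Nat.le_induction with
  | base =>
    have h0 : infoDet k lam (fun s : (∅ : Finset ℕ) => x s) = 1 := by simp [infoDet]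
    have h : Finset.Ico a a = ∅ := Finset.Ico_self a
    rw [h, h0]; simp
  | succ b hab ih =>
    have hins : Finset.Ico a (b + 1) = insert b (Finset.Ico a b) := by
      ext i; simp only [Finset.mem_Ico, Finset.mem_insert]; omega
    rw [Finset.sum_Ico_succ_top hab, ih, hins, infoDet_insert hk hlam x _ (by simp), Real.log_mul]
    · exact (zero_lt_one.trans_le (infoDet_mem_Icc hk hlam hk1 _).1).ne'
    · have := div_nonneg (postCov_self_nonneg hk hlam
        (fun s : Finset.Ico a b => x s) (x b)) hlam.le
      positivity

theorem swStd_sq (hk : ∀ x y, k x y = inner ℝ (φ x) (φ y)) (hlam : 0 < lam) (w t : ℕ)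
    (x : ℕ → X) (z : X) :
    swStd k lam w x t z ^ 2 = postCov k lam (fun s : window w t => x s) z z :=
  Real.sq_sqrt (postCov_self_nonneg hk hlam _ _)

/-- In a block of `w` rounds every window contains the part of the block before it, so that the
sliding-window variances are dominated by those of a Gaussian process restarted at the beginning of
the block. -/
theorem sum_block_swStd_sq_le [Nonempty X] (hk : ∀ x y, k x y = inner ℝ (φ x) (φ y))
    (hlam : 0 < lam) (hk1 : ∀ x, k x x ≤ 1) (w : ℕ) (x : ℕ → X) {a : ℕ} (ha : 1 ≤ a) :
    ∑ t ∈ Finset.Ico a (a + w), swStd k lam w x t (x t) ^ 2 ≤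
      2 / Real.log (1 + 1 / lam) * maxInfoGain k lam w := by
  have hl : 0 < Real.log (1 + 1 / lam) := Real.log_pos (by simpa using hlam)
  calc _ ≤ ∑ t ∈ Finset.Ico a (a + w),
        Real.log (1 + postCov k lam (fun s : Finset.Ico a t => x s) (x t) (x t) / lam) /
          Real.log (1 + 1 / lam) := by
        refine Finset.sum_le_sum fun t ht => ?_
        rw [Finset.mem_Ico] at ht
        have hsub : ∀ s ∈ Finset.Ico a t, s ∈ window w t := fun s hs => by
          rw [Finset.mem_Ico] at hs; rw [window, Finset.mem_Ico]; omega
        rw [swStd_sq hk hlam]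
        refine (postCov_self_anti hk hlam (fun s : window w t => x s)
          ⟨fun s : Finset.Ico a t => ⟨s, hsub s s.2⟩, fun s s' h => ?_⟩ (x t)).trans ?_
        · exact Subtype.ext (Subtype.mk.inj h)
        · exact le_log_one_add_div hlam (postCov_self_nonneg hk hlam _ _)
            ((postCov_self_le_kernel hk hlam _ _).trans (hk1 _))
    _ = Real.log (infoDet k lam (fun s : Finset.Ico a (a + w) => x s)) /
          Real.log (1 + 1 / lam) := by
        rw [← Finset.sum_div, sum_log_one_add_postCov hk hlam hk1 x (Nat.le_add_right a w)]
    _ ≤ 2 * maxInfoGain k lam w / Real.log (1 + 1 / lam) := by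
        have h := log_infoDet_le hk hlam hk1 (fun s : Finset.Ico a (a + w) => x s)
        rw [Fintype.card_coe, Nat.card_Ico, Nat.add_sub_cancel_left] at h
        gcongr
    _ = _ := by ring

theorem sum_swStd_le [Nonempty X] (hk : ∀ x y, k x y = inner ℝ (φ x) (φ y))
    (hlam : 0 < lam) (hk1 : ∀ x, k x x ≤ 1) {w T : ℕ} (hw : 1 ≤ w) (hwT : w ≤ T) (x : ℕ → X) :
    ∑ t ∈ Finset.Icc 1 T, swStd k lam w x t (x t) ≤
      √(2 * (2 / Real.log (1 + 1 / lam))) * (T * √(maxInfoGain k lam w / w)) := by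
  set G := 2 / Real.log (1 + 1 / lam) with hG
  have hl : 0 < Real.log (1 + 1 / lam) := Real.log_pos (by simpa using hlam)
  have hG0 : 0 < G := by positivity
  have hγ := maxInfoGain_nonneg hk hlam hk1 w
  have hw0 : (0 : ℝ) < w := by exact_mod_cast hw
  have hblocks (m : ℕ) : ∑ t ∈ Finset.Ico 1 (1 + m * w), swStd k lam w x t (x t) ^ 2 ≤
      m * (G * maxInfoGain k lam w) := by
    induction m with
    | zero => simp
    | succ m ih =>
      have h1 : 1 + (m + 1) * w = 1 + m * w + w := by ring
      rw [h1, ← Finset.sum_Ico_consecutive _ (Nat.le_add_right 1 (m * w)) (Nat.le_add_right _ w)]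
      have := sum_block_swStd_sq_le hk hlam hk1 w x (Nat.le_add_right 1 (m * w))
      push_cast
      linarith
  have hsq : ∑ t ∈ Finset.Icc 1 T, swStd k lam w x t (x t) ^ 2 ≤
      2 * T / w * (G * maxInfoGain k lam w) := by
    have hsub : Finset.Icc 1 T ⊆ Finset.Ico 1 (1 + (T / w + 1) * w) := by
      intro t ht
      rw [Finset.mem_Icc] at ht
      rw [Finset.mem_Ico]
      have := Nat.lt_div_mul_add (a := T) hw
      refine ⟨ht.1, ?_⟩
      rw [Nat.add_mul, Nat.one_mul]
      omega
    refine (Finset.sum_le_sum_of_subset_of_nonneg hsub fun _ _ _ => sq_nonneg _).trans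
      ((hblocks _).trans ?_)
    have h2 : ((T / w + 1 : ℕ) : ℝ) ≤ 2 * T / w := by
      have h3 : ((T / w : ℕ) : ℝ) ≤ T / w := Nat.cast_div_le
      have h4 : (1 : ℝ) ≤ T / w := by rw [le_div_iff₀ hw0, one_mul]; exact_mod_cast hwT
      push_cast
      have h5 : 2 * (T : ℝ) / w = T / w + T / w := by ring
      linarith
    gcongr
  have hcs : (∑ t ∈ Finset.Icc 1 T, swStd k lam w x t (x t)) ^ 2 ≤
      T * ∑ t ∈ Finset.Icc 1 T, swStd k lam w x t (x t) ^ 2 := by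
    have := sq_sum_le_card_mul_sum_sq (s := Finset.Icc 1 T)
      (f := fun t => swStd k lam w x t (x t))
    rwa [Nat.card_Icc, Nat.add_sub_cancel] at this
  have hrhs : √(2 * G) * (T * √(maxInfoGain k lam w / w)) =
      √(T * (2 * T / w * (G * maxInfoGain k lam w))) := by
    have e : T * (2 * T / w * (G * maxInfoGain k lam w)) =
        (2 * G) * ((T : ℝ) ^ 2 * (maxInfoGain k lam w / w)) := by field_simp
    rw [e, Real.sqrt_mul (by positivity : 0 ≤ 2 * G), Real.sqrt_mul (sq_nonneg (T : ℝ)),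
      Real.sqrt_sq (Nat.cast_nonneg T)]
  rw [hrhs]
  refine Real.le_sqrt_of_sq_le (hcs.trans ?_)
  gcongr

end Windows

/-! ### The regret on the confidence event -/

section Regret

variable {X H : Type*} [NormedAddCommGroup H] [InnerProductSpace ℝ H]
  {k : X → X → ℝ} {lam : ℝ} {φ : X → H}

/-- The constant of the regret bound. Its three terms come from the first round, from the cumulative
posterior variance and from the drift of the reward functions. -/
noncomputable def regretConst (lam : ℝ) : ℝ :=
  2 * √(2 / Real.log (1 + 1 / lam)) + 2 * √(2 * (2 / Real.log (1 + 1 / lam))) +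
    2 * √(2 / Real.log (1 + 1 / lam) / lam)

theorem regretConst_pos (hlam : 0 < lam) : 0 < regretConst lam := by
  have hl : 0 < Real.log (1 + 1 / lam) := Real.log_pos (by simpa using hlam)
  have : 0 < √(2 / Real.log (1 + 1 / lam)) := Real.sqrt_pos.2 (by positivity)
  unfold regretConst
  positivity

theorem confWidth_mono [Nonempty X] (hk : ∀ x y, k x y = inner ℝ (φ x) (φ y)) (hlam : 0 < lam)
    (hk1 : ∀ x, k x x ≤ 1) {B R δ : ℝ} (hR : 0 ≤ R) (T : ℕ) :
    Monotone (confWidth k lam B R δ T) := by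
  intro n m hnm
  have := maxInfoGain_mono hk hlam hk1 hnm
  unfold confWidth
  gcongr

/-- Optimism: the regret of a round is at most twice the width of the confidence band. -/
theorem round_regret_le [Nonempty X] (hk : ∀ x y, k x y = inner ℝ (φ x) (φ y)) (hlam : 0 < lam)
    (hk1 : ∀ x, k x x ≤ 1) {B R δ : ℝ} {T w t : ℕ} (hR : 0 ≤ R) (hw : 1 ≤ w)
    {f : ℕ → H} (hf : ‖f t‖ ≤ B) {x : ℕ → X} {y η : ℕ → ℝ}
    (hy : ∀ s, y s = inner ℝ (φ (x s)) (f s) + η s)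
    (hrun : ∀ z, ucb k lam B R δ T w x y t z ≤ ucb k lam B R δ T w x y t (x t))
    (hη : noiseForm k lam (fun s : window w t => x s) (fun s => η s) ≤
      R ^ 2 * (Real.log (infoDet k lam (fun s : window w t => x s)) + 2 * Real.log (T / δ))) :
    (⨆ z, inner ℝ (φ z) (f t)) - inner ℝ (φ (x t)) (f t) ≤
      2 * (confWidth k lam B R δ T w * swStd k lam w x t (x t)) +
        2 * (√(2 / Real.log (1 + 1 / lam) * maxInfoGain k lam w / lam) * √w *
          ∑ r ∈ window w t, ‖f (r + 1) - f r‖) := by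
  set β := confWidth k lam B R δ T (min t w) with hβ
  have hgain : Real.log (infoDet k lam (fun s : window w t => x s)) ≤
      2 * maxInfoGain k lam (min t w) := by
    have h1 := log_infoDet_le hk hlam hk1 (fun s : window w t => x s)
    rw [Fintype.card_coe] at h1
    have h2 := maxInfoGain_mono hk hlam hk1 (card_window_le w t)
    linarith
  have hη' := hη.trans (show _ ≤ R ^ 2 * (2 * maxInfoGain k lam (min t w) +
    2 * Real.log (T / δ)) by gcongr)
  have hwidth : B + √(R ^ 2 * (2 * maxInfoGain k lam (min t w) + 2 * Real.log (T / δ)) / lam) =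
      β := by
    rw [hβ, confWidth, Real.sqrt_div' _ hlam.le, Real.sqrt_mul (sq_nonneg R), Real.sqrt_sq hR]
    ring
  have hband := abs_swMean_sub_le hk hlam hk1
    (kernel_self_le_maxInfoGain hk hlam hk1 hw) hf hy hη'
  rw [hwidth] at hband
  have hβw : β ≤ confWidth k lam B R δ T w := confWidth_mono hk hlam hk1 hR T (min_le_right _ _)
  have hσ : 0 ≤ swStd k lam w x t (x t) := Real.sqrt_nonneg _
  have hmul := mul_le_mul_of_nonneg_right hβw hσ
  rw [sub_le_iff_le_add]
  refine ciSup_le fun z => ?_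
  have h1 := abs_le.1 (hband z)
  have h2 := abs_le.1 (hband (x t))
  have h3 := hrun z
  simp only [ucb, ← hβ] at h3
  linarith

theorem first_regret_le [Nonempty X] (hk : ∀ x y, k x y = inner ℝ (φ x) (φ y)) {B κ : ℝ}
    (hκ : ∀ x, k x x ≤ κ) {g : H} (hg : ‖g‖ ≤ B) (z₀ : X) :
    (⨆ z, inner ℝ (φ z) g) - inner ℝ (φ z₀) g ≤ 2 * (√κ * B) := by
  have h (z : X) : |inner ℝ (φ z) g| ≤ √κ * B := by
    refine (abs_real_inner_le_norm _ _).trans ?_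
    have : ‖φ z‖ ≤ √κ := by
      refine Real.le_sqrt_of_sq_le ?_
      rw [← real_inner_self_eq_norm_sq, ← hk]; exact hκ z
    gcongr
  have h0 := abs_le.1 (h z₀)
  have h1 : (⨆ z, inner ℝ (φ z) g) ≤ √κ * B := ciSup_le fun z => (abs_le.1 (h z)).2
  linarith

/-- The regret bound for a run along which all the noise quadratic forms are controlled. -/
theorem dynamicRegret_le [Nonempty X] (hk : ∀ x y, k x y = inner ℝ (φ x) (φ y)) (hlam : 0 < lam)
    (hk1 : ∀ x, k x x ≤ 1) {B R δ P : ℝ} {T w : ℕ} (hR : 0 ≤ R) (hw : 1 ≤ w) (hwT : w ≤ T)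
    {f : ℕ → H} (hf : ∀ t ∈ Finset.Icc 1 T, ‖f t‖ ≤ B)
    (hP : ∑ t ∈ Finset.Ico 1 T, ‖f (t + 1) - f t‖ ≤ P) {x : ℕ → X} {y η : ℕ → ℝ}
    (hy : ∀ s, y s = inner ℝ (φ (x s)) (f s) + η s)
    (hrun : IsRun k lam B R δ T w x y)
    (hη : ∀ t ∈ Finset.Icc 2 T, noiseForm k lam (fun s : window w t => x s) (fun s => η s) ≤
      R ^ 2 * (Real.log (infoDet k lam (fun s : window w t => x s)) + 2 * Real.log (T / δ))) :
    dynamicRegret (fun t z => inner ℝ (φ z) (f t)) x T ≤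
      regretConst lam * (√(maxInfoGain k lam w) * (w : ℝ) ^ (3 / 2 : ℝ) * P +
        confWidth k lam B R δ T w * T * √(maxInfoGain k lam w / w)) := by
  have hl : 0 < Real.log (1 + 1 / lam) := Real.log_pos (by simpa using hlam)
  have hT : 1 ≤ T := hw.trans hwT
  have hγ := maxInfoGain_nonneg hk hlam hk1 w
  have hw0 : (0 : ℝ) < w := by exact_mod_cast hw
  set G := 2 / Real.log (1 + 1 / lam) with hG
  have hG0 : 0 < G := by positivity
  set γ := maxInfoGain k lam w with hγdef
  set β := confWidth k lam B R δ T w with hβ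
  have hB0 : 0 ≤ B := (norm_nonneg _).trans (hf 1 (Finset.mem_Icc.2 ⟨le_rfl, hT⟩))
  have hBβ : B ≤ β := by
    rw [hβ, confWidth]
    have : 0 ≤ 1 / √lam * R * √(2 * maxInfoGain k lam w + 2 * Real.log (T / δ)) := by positivity
    linarith
  have hβ0 : 0 ≤ β := hB0.trans hBβ
  have hP0 : 0 ≤ P := (Finset.sum_nonneg fun _ _ => norm_nonneg _).trans hP
  set V := T * √(γ / w) with hV
  set Dr := √γ * (w : ℝ) ^ (3 / 2 : ℝ) * P with hDr
  have hV0 : 0 ≤ V := by positivity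
  have hDr0 : 0 ≤ Dr := by positivity
  -- the first round, whose query is unconstrained
  have hfirst : (⨆ z, inner ℝ (φ z) (f 1)) - inner ℝ (φ (x 1)) (f 1) ≤ 2 * √G * (β * V) := by
    refine (first_regret_le hk (kernel_self_le_maxInfoGain hk hlam hk1 hw)
      (hf 1 (Finset.mem_Icc.2 ⟨le_rfl, hT⟩)) (x 1)).trans ?_
    have hγV : √γ ≤ V := by
      rw [hV, Real.sqrt_div hγ]
      have h1 : √(w : ℝ) ≤ T := by
        refine le_trans ?_ (Nat.cast_le.2 hwT : (w : ℝ) ≤ T)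
        rw [Real.sqrt_le_left hw0.le]
        exact le_self_pow₀ (by exact_mod_cast hw) two_ne_zero
      rw [← mul_div_assoc, le_div_iff₀ (Real.sqrt_pos.2 hw0), mul_comm]
      gcongr
    rw [← hγdef, ← hG, Real.sqrt_mul hG0.le]
    calc 2 * (√G * √γ * B) = 2 * √G * (B * √γ) := by ring
      _ ≤ 2 * √G * (β * V) := by gcongr
  have hround (t : ℕ) (ht : t ∈ Finset.Icc 2 T) :=
    round_regret_le hk hlam hk1 hR hw (hf t (Finset.Icc_subset_Icc_left one_le_two ht)) hy
      (hrun t ht) (hη t ht)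
  rw [← hG, ← hβ, ← hγdef] at hround
  have hsplit : Finset.Icc 1 T = insert 1 (Finset.Icc 2 T) := by
    ext i; simp only [Finset.mem_Icc, Finset.mem_insert]; omega
  have hσ : ∑ t ∈ Finset.Icc 2 T, swStd k lam w x t (x t) ≤ √(2 * G) * V := by
    refine le_trans ?_ (sum_swStd_le hk hlam hk1 hw hwT x)
    exact Finset.sum_le_sum_of_subset_of_nonneg (Finset.Icc_subset_Icc_left one_le_two)
      fun _ _ _ => Real.sqrt_nonneg _
  have hD : ∑ t ∈ Finset.Icc 2 T, ∑ r ∈ window w t, ‖f (r + 1) - f r‖ ≤ w * P :=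
    (sum_sum_window_le (fun _ => norm_nonneg _) w T).trans (by gcongr)
  have hsqrt : √(G * γ / lam) = √(G / lam) * √γ := by
    rw [← Real.sqrt_mul (by positivity)]; congr 1; ring
  have hpow : (w : ℝ) ^ (3 / 2 : ℝ) = √w * w := by
    rw [Real.sqrt_eq_rpow]
    nth_rewrite 3 [← Real.rpow_one (w : ℝ)]
    rw [← Real.rpow_add hw0]; norm_num
  calc dynamicRegret (fun t z => inner ℝ (φ z) (f t)) x T
      = ((⨆ z, inner ℝ (φ z) (f 1)) - inner ℝ (φ (x 1)) (f 1)) +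
        ∑ t ∈ Finset.Icc 2 T, ((⨆ z, inner ℝ (φ z) (f t)) - inner ℝ (φ (x t)) (f t)) := by
        rw [dynamicRegret, hsplit, Finset.sum_insert (by simp)]
    _ ≤ 2 * √G * (β * V) + ∑ t ∈ Finset.Icc 2 T, (2 * (β * swStd k lam w x t (x t)) +
        2 * (√(G * γ / lam) * √w * ∑ r ∈ window w t, ‖f (r + 1) - f r‖)) :=
        add_le_add hfirst (Finset.sum_le_sum hround)
    _ = 2 * √G * (β * V) + 2 * (β * ∑ t ∈ Finset.Icc 2 T, swStd k lam w x t (x t)) +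
        2 * (√(G * γ / lam) * √w *
          ∑ t ∈ Finset.Icc 2 T, ∑ r ∈ window w t, ‖f (r + 1) - f r‖) := by
        rw [Finset.sum_add_distrib, ← Finset.mul_sum, ← Finset.mul_sum, ← Finset.mul_sum,
          ← Finset.mul_sum]
        ring
    _ ≤ 2 * √G * (β * V) + 2 * (β * (√(2 * G) * V)) +
        2 * (√(G * γ / lam) * √w * (w * P)) := by gcongr
    _ = (2 * √G + 2 * √(2 * G)) * (β * V) + 2 * √(G / lam) * Dr := by
        rw [hsqrt, hDr, hpow]; ring
    _ ≤ regretConst lam * (β * V) + regretConst lam * Dr := by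
        have h1 : 2 * √G + 2 * √(2 * G) ≤ regretConst lam := by
          rw [regretConst, ← hG]
          have := Real.sqrt_nonneg (G / lam)
          linarith
        have h2 : 2 * √(G / lam) ≤ regretConst lam := by
          rw [regretConst, ← hG]
          have := Real.sqrt_nonneg G
          have := Real.sqrt_nonneg (2 * G)
          linarith
        gcongr
    _ = _ := by rw [hV]; ring

end Regret

/-! ### Kernel features and the history of a run -/

section History

variable {X H : Type*} [NormedAddCommGroup H] [InnerProductSpace ℝ H]

theorem continuous_feature [TopologicalSpace X] {k : X → X → ℝ} {φ : X → H}
    (hk : ∀ x y, k x y = inner ℝ (φ x) (φ y)) (hc : Continuous fun q : X × X => k q.1 q.2) :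
    Continuous φ := by
  refine continuous_iff_continuousAt.2 fun x => ?_
  rw [ContinuousAt, tendsto_iff_norm_sub_tendsto_zero]
  have e (y : X) : ‖φ y - φ x‖ = √(k y y - 2 * k y x + k x x) := by
    rw [hk, hk, hk, real_inner_self_eq_norm_sq, real_inner_self_eq_norm_sq, ← norm_sub_sq_real,
      Real.sqrt_sq (norm_nonneg _)]
  simp only [e]
  have h1 : Continuous fun y => k y y := hc.comp (continuous_id.prodMk continuous_id)
  have h2 : Continuous fun y => k y x := hc.comp (continuous_id.prodMk continuous_const)
  have h3 : Continuous fun y => √(k y y - 2 * k y x + k x x) := by fun_prop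
  have := h3.tendsto x
  rwa [show k x x - 2 * k x x + k x x = 0 by ring, Real.sqrt_zero] at this

variable {Ω : Type*} [MeasurableSpace X] {x : ℕ → Ω → X}

theorem measurable_history_query {y : ℕ → Ω → ℝ} {s t : ℕ} (hs : 1 ≤ s) (hst : s ≤ t) :
    Measurable[history x y t] (x s) :=
  measurable_iff_comap_le.2 (le_sup_of_le_left
    (le_iSup₂_of_le s (Finset.mem_Icc.2 ⟨hs, hst⟩) le_rfl))

theorem measurable_history_reward {y : ℕ → Ω → ℝ} {s t : ℕ} (hs : 1 ≤ s) (hst : s < t) :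
    Measurable[history x y t] (y s) :=
  measurable_iff_comap_le.2 (le_sup_of_le_right
    (le_iSup₂_of_le s (Finset.mem_Ico.2 ⟨hs, hst⟩) le_rfl))

/-- Since the reward functions are deterministic, the past noise can be read off from the past
queries and rewards. -/
theorem measurable_history_noise {f : ℕ → X → ℝ} (hf : ∀ s, Measurable (f s)) {η : ℕ → Ω → ℝ}
    {s t : ℕ} (hs : 1 ≤ s) (hst : s < t) : Measurable[history x (reward f x η) t] (η s) := by
  have h : η s = fun ω => reward f x η s ω - f s (x s ω) := by
    ext ω; simp [reward]
  rw [h]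
  exact (measurable_history_reward hs hst).sub
    ((hf s).comp (measurable_history_query hs hst.le))

theorem history_le [mΩ : MeasurableSpace Ω] {y : ℕ → Ω → ℝ} {t : ℕ}
    (hx : ∀ s ∈ Finset.Icc 1 t, Measurable (x s)) (hy : ∀ s ∈ Finset.Ico 1 t, Measurable (y s)) :
    history x y t ≤ mΩ :=
  sup_le (iSup₂_le fun s hs => (hx s hs).comap_le) (iSup₂_le fun s hs => (hy s hs).comap_le)

end History

end SWGPUCB

/-! ### The regret bound with high probability -/

theorem theorem2 (lam : ℝ) (hlam : 0 < lam) :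
    ∃ C : ℝ, 0 < C ∧
      -- the domain, the kernel and its reproducing kernel Hilbert space
      ∀ (d : ℕ) (X : Set (EuclideanSpace ℝ (Fin d))), IsCompact X → X.Nonempty →
      ∀ (H : Type*) [NormedAddCommGroup H] [InnerProductSpace ℝ H] [CompleteSpace H]
        [RKHS ℝ H X ℝ] (k : X → X → ℝ),
        (∀ x y : X, RKHS.kernel H x y 1 = k x y) →
        Continuous (fun q : X × X => k q.1 q.2) →
        (∀ x : X, k x x ≤ 1) →
      -- the parameters and the unknown functions
      ∀ (B R δ P : ℝ) (T w : ℕ), 0 ≤ R → 0 < δ → δ < 1 → 1 ≤ w → w ≤ T →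
      ∀ f : ℕ → H,
        (∀ t ∈ Finset.Icc 1 T, ‖f t‖ ≤ B) →
        (∑ t ∈ Finset.Ico 1 T, ‖f (t + 1) - f t‖ ≤ P) →
      -- the random query points and the noise
      ∀ (Ω : Type*) [MeasurableSpace Ω] (μ : Measure Ω) [IsProbabilityMeasure μ]
        (x : ℕ → Ω → X) (η : ℕ → Ω → ℝ),
        (∀ t ∈ Finset.Icc 1 T, Measurable (x t)) →
        (∀ t ∈ Finset.Icc 1 T, Measurable (η t)) →
        (∀ t ∈ Finset.Icc 1 T, SWGPUCB.CondSubGaussian μ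
          (SWGPUCB.history x (SWGPUCB.reward (fun t => ⇑(f t)) x η) t) R (η t)) →
        (∀ᵐ ω ∂μ, SWGPUCB.IsRun k lam B R δ T w (fun t => x t ω)
          (fun t => SWGPUCB.reward (fun t => ⇑(f t)) x η t ω)) →
      1 - δ ≤ μ.real {ω |
        SWGPUCB.dynamicRegret (fun t => ⇑(f t)) (fun t => x t ω) T ≤
          C * (Real.sqrt (SWGPUCB.maxInfoGain k lam w) * (w : ℝ) ^ (3 / 2 : ℝ) * P +
            SWGPUCB.confWidth k lam B R δ T w * (T : ℝ) *
              Real.sqrt (SWGPUCB.maxInfoGain k lam w / (w : ℝ)))} := by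
  refine ⟨SWGPUCB.regretConst lam, SWGPUCB.regretConst_pos hlam, ?_⟩
  intro d X _ hXne H _ _ _ _ k hker hkc hk1 B R δ P T w hR hδ _ hw hwT f hf hP Ω _ μ _ x η hx hη
    hsub hrun
  have : Nonempty X := hXne.to_subtype
  have hT : 1 ≤ T := hw.trans hwT
  have hT0 : (0 : ℝ) < T := by exact_mod_cast hT
  set φ : X → H := fun z => RKHS.kerFun H z 1 with hφ
  have hk (z z' : X) : k z z' = inner ℝ (φ z) (φ z') := by
    rw [← hker, ← RKHS.kerFun_apply, hφ]
    simp only [RKHS.kerFun_inner]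
    simp
  have hfφ (g : H) (z : X) : g z = inner ℝ (φ z) g := by simp [hφ]
  have hfm (t : ℕ) : Measurable ⇑(f t) := by
    have : ⇑(f t) = fun z => inner ℝ (φ z) (f t) := funext (hfφ (f t))
    rw [this]
    exact ((SWGPUCB.continuous_feature hk hkc).inner continuous_const).measurable
  have hrew (t : ℕ) (ht : t ∈ Finset.Icc 1 T) :
      Measurable (SWGPUCB.reward (fun t => ⇑(f t)) x η t) :=
    ((hfm t).comp (hx t ht)).add (hη t ht)
  -- the event that the noise in the window of round `t` leaves its confidence set
  set bad : ℕ → Set Ω := fun t => {ω | R ^ 2 * (Real.log (SWGPUCB.infoDet k lam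
      (fun i : SWGPUCB.window w t => x i ω)) + 2 * Real.log (1 / (δ / T))) <
      SWGPUCB.noiseForm k lam (fun i : SWGPUCB.window w t => x i ω) (fun i => η i ω)} with hbad
  have hbadle (t : ℕ) (ht : t ∈ Finset.Icc 2 T) : μ (bad t) ≤ ENNReal.ofReal (δ / T) := by
    rw [Finset.mem_Icc] at ht
    have hmem (s : ℕ) (h1 : max 1 (t - w) ≤ s) (h2 : s < t) : s ∈ Finset.Icc 1 T :=
      Finset.mem_Icc.2 ⟨(le_max_left _ _).trans h1, h2.le.trans ht.2⟩
    refine SWGPUCB.measure_noiseForm_gt_le (a := max 1 (t - w)) (b := t)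
      (F := SWGPUCB.history x (SWGPUCB.reward (fun t => ⇑(f t)) x η))
      hk hlam hk1 hkc.measurable hR (by omega) (fun s h1 h2 => ?_)
      (fun s r h1 h2 h3 => ?_) (fun s r h1 h2 h3 => ?_) (fun s h1 h2 => hη s (hmem s h1 h2))
      (fun s h1 h2 => hsub s (hmem s h1 h2)) (by positivity)
    · refine SWGPUCB.history_le (fun r hr => hx r ?_) (fun r hr => hrew r ?_)
      · rw [Finset.mem_Icc] at hr ⊢; omega
      · rw [Finset.mem_Ico] at hr; rw [Finset.mem_Icc]; omega
    · exact SWGPUCB.measurable_history_query ((le_max_left _ _).trans h1) h2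
    · exact SWGPUCB.measurable_history_noise hfm ((le_max_left _ _).trans h1) h2
  set S := {ω | SWGPUCB.dynamicRegret (fun t => ⇑(f t)) (fun t => x t ω) T ≤
    SWGPUCB.regretConst lam * (Real.sqrt (SWGPUCB.maxInfoGain k lam w) * (w : ℝ) ^ (3 / 2 : ℝ) * P +
      SWGPUCB.confWidth k lam B R δ T w * (T : ℝ) *
        Real.sqrt (SWGPUCB.maxInfoGain k lam w / (w : ℝ)))} with hS
  have hgood : ∀ᵐ ω ∂μ, ω ∉ ⋃ t ∈ Finset.Icc 2 T, bad t → ω ∈ S := by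
    filter_upwards [hrun] with ω hω hnot
    have hb : ∀ t ∈ Finset.Icc 2 T,
        SWGPUCB.noiseForm k lam (fun i : SWGPUCB.window w t => x i ω) (fun i => η i ω) ≤
        R ^ 2 * (Real.log (SWGPUCB.infoDet k lam
          (fun i : SWGPUCB.window w t => x i ω)) + 2 * Real.log (T / δ)) := by
      intro t ht
      rw [← one_div_div δ (T : ℝ)]
      refine not_lt.1 fun h => hnot ?_
      exact Set.mem_biUnion (t := bad) ht h
    have hreg := SWGPUCB.dynamicRegret_le hk hlam hk1 hR hw hwT hf hP
      (x := fun t => x t ω) (η := fun t => η t ω)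
      (fun s => by simp only [SWGPUCB.reward, hfφ]) hω hb
    have heq : (fun t => ⇑(f t)) = fun t z => inner ℝ (φ z) (f t) := by
      ext t z; exact hfφ (f t) z
    rw [hS, Set.mem_ofPred_eq, heq]
    exact hreg
  have hcompl : μ Sᶜ ≤ ENNReal.ofReal δ := by
    calc μ Sᶜ ≤ μ (⋃ t ∈ Finset.Icc 2 T, bad t) := by
          refine measure_mono_ae ?_
          filter_upwards [hgood] with ω hω hωS
          by_contra h
          exact hωS (hω h)
      _ ≤ ∑ t ∈ Finset.Icc 2 T, μ (bad t) := measure_biUnion_finset_le _ _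
      _ ≤ ∑ t ∈ Finset.Icc 2 T, ENNReal.ofReal (δ / T) := Finset.sum_le_sum hbadle
      _ ≤ ∑ t ∈ Finset.Icc 1 T, ENNReal.ofReal (δ / T) :=
          Finset.sum_le_sum_of_subset (Finset.Icc_subset_Icc_left one_le_two)
      _ = ENNReal.ofReal δ := by
          rw [Finset.sum_const, Nat.card_Icc, Nat.add_sub_cancel, nsmul_eq_mul,
            ← ENNReal.ofReal_natCast, ← ENNReal.ofReal_mul hT0.le, mul_div_cancel₀ _ hT0.ne']
  have hone : (1 : ℝ) ≤ μ.real S + μ.real Sᶜ := by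
    have := measureReal_union_le (μ := μ) S Sᶜ
    rwa [Set.union_compl_self, probReal_univ] at this
  have hcompl' : μ.real Sᶜ ≤ δ := ENNReal.toReal_le_of_le_ofReal hδ.le hcompl
  linarith
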